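/- Let $d\ge 3$ be an integer, $a_c:=\frac{d-2}{2}$, $$\Lambda_\star:=(d-1)\,e\,\bigl(2^{d+1}\pi\bigr)^{-\frac1{d-1}}\,\Gamma(d/2)^{\frac2{d-1}},\qquad a_\star:=a_c-\sqrt{\Lambda_\star}.$$ Let $\mathsf C_{\rm LS}$ be the optimal (smallest) constant in Gross' logarithmic Sobolev inequality in scale invariant form, $$\exp\Bigl(\tfrac 2d\int_{\mathbb R^d}|u|^2\log|u|^2\,dx\Bigr)\le \mathsf C_{\rm LS}\int_{\mathbb R^d}|\nabla u|^2\,dx\qquad\text{for all }u\in H^1(\mathbb R^d)\text{ with }\int_{\mathbb R^d}|u|^2\,dx=1 .$$ For $a<a_c$, let $\mathcal D^{1,2}_a(\mathbb R^d)$ be the completion of $C_c^\infty(\mathbb R^d\setminus\{0\})$ with respect to the norm $u\mapsto\bigl(\int_{\mathbb R^d}|x|^{-2a}|\nabla u|^2\,dx\bigr)^{1/2}$, and for $\gamma\ge d/4$ let $\mathsf C^*_{\rm WLH}(\gamma,a)$ be the optimal (smallest) constant for which the weighted logarithmic Hardy inequality $$\int_{\mathbb R^d}\frac{|u|^2}{|x|^{2(a+1)}}\log\bigl(|x|^{2(a_c-a)}|u|^2\bigr)\,dx\le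 2\gamma\log\Bigl[\mathsf C^*_{\rm WLH}(\gamma,a)\int_{\mathbb R^d}\frac{|\nabla u|^2}{|x|^{2a}}\,dx\Bigr]$$ holds for all radial functions $u\in\mathcal D^{1,2}_a(\mathbb R^d)$ with $\int_{\mathbb R^d}|x|^{-2(a+1)}|u|^2\,dx=1$. If $a\in(a_\star,a_c)$, then $$\mathsf C_{\rm LS}=\frac{2}{\pi\,d\,e}<\mathsf C^*_{\rm WLH}\bigl(\tfrac d4,a\bigr).$$ -/

import Mathlib

open MeasureTheory Filter Topology
open scoped ENNReal NNReal ContDiff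

noncomputable section

/-- `u` belongs to the completion of `C_c^∞(Ω)`, `Ω ⊆ ℝ^d`, for the norm
`(‖ |x|^{-α} ∇u ‖₂² + ‖ |x|^{-β} u ‖₂²)^{1/2}`, and `g` is its gradient: both are limits, in the
respective weighted `L²` spaces, of a common sequence of test functions. -/
structure IsSobolevLimit {d : ℕ} (Ω : Set (EuclideanSpace ℝ (Fin d))) (α β : ℝ)
    (u : EuclideanSpace ℝ (Fin d) → ℝ)
    (g : EuclideanSpace ℝ (Fin d) → EuclideanSpace ℝ (Fin d)) : Prop where
  aestronglyMeasurable_fun : AEStronglyMeasurable u volume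
  aestronglyMeasurable_grad : AEStronglyMeasurable g volume
  exists_seq : ∃ φ : ℕ → EuclideanSpace ℝ (Fin d) → ℝ,
    (∀ n, ContDiff ℝ ∞ (φ n) ∧ HasCompactSupport (φ n) ∧ tsupport (φ n) ⊆ Ω) ∧
    Tendsto (fun n => ∫⁻ x, ENNReal.ofReal (‖x‖ ^ (-2 * α) * ‖gradient (φ n) x - g x‖ ^ 2))
      atTop (𝓝 0) ∧
    Tendsto (fun n => ∫⁻ x, ENNReal.ofReal (‖x‖ ^ (-2 * β) * (φ n x - u x) ^ 2))
      atTop (𝓝 0)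

/-- `u ∈ H¹(ℝ^d)` with gradient `g`; `H¹(ℝ^d)` is the completion of `C_c^∞(ℝ^d)` for the norm
`(‖∇u‖₂² + ‖u‖₂²)^{1/2}`. -/
def MemH1 {d : ℕ} (u : EuclideanSpace ℝ (Fin d) → ℝ)
    (g : EuclideanSpace ℝ (Fin d) → EuclideanSpace ℝ (Fin d)) : Prop :=
  IsSobolevLimit Set.univ 0 0 u g

/-- `u ∈ 𝒟_a^{1,2}(ℝ^d)` with gradient `g`, for `a < (d - 2) / 2`. The space is the completion of
`C_c^∞(ℝ^d ∖ {0})` for the norm `‖ |x|^{-a} ∇u ‖₂`; by Hardy's inequality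
`((d - 2) / 2 - a)² ‖ |x|^{-(a+1)} u ‖₂² ≤ ‖ |x|^{-a} ∇u ‖₂²` for test functions `u`,
adding the term `‖ |x|^{-(a+1)} u ‖₂²` gives an equivalent norm, and this realizes
the completion as a space of functions. -/
def MemD12 {d : ℕ} (a : ℝ) (u : EuclideanSpace ℝ (Fin d) → ℝ)
    (g : EuclideanSpace ℝ (Fin d) → EuclideanSpace ℝ (Fin d)) : Prop :=
  IsSobolevLimit {0}ᶜ a (a + 1) u g

/-- `a_c = (d - 2) / 2`. -/
def aCrit (d : ℕ) : ℝ := ((d : ℝ) - 2) / 2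

/-- `C` is admissible in the scale invariant logarithmic Sobolev inequality:
`exp ((2 / d) ∫ |u|² log |u|²) ≤ C ‖∇u‖₂²` for all `u ∈ H¹(ℝ^d)` with `‖u‖₂ = 1`.
(If `|u|² log |u|²` is not integrable, its integral is `-∞`, because its positive part is always
integrable, and there is nothing to require.) -/
def LSHolds (d : ℕ) (C : ℝ) : Prop :=
  ∀ (u : EuclideanSpace ℝ (Fin d) → ℝ) (g : EuclideanSpace ℝ (Fin d) → EuclideanSpace ℝ (Fin d)),
    MemH1 u g →
    ∫ x, u x ^ 2 = 1 →
    Integrable (fun x => u x ^ 2 * Real.log (u x ^ 2)) →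
    Real.exp (2 / d * ∫ x, u x ^ 2 * Real.log (u x ^ 2)) ≤ C * ∫ x, ‖g x‖ ^ 2

/-- The optimal constant in Gross' logarithmic Sobolev inequality (scale invariant form). -/
def CLS (d : ℕ) : ℝ≥0∞ :=
  ⨅ (C : ℝ≥0) (_ : LSHolds d C), (C : ℝ≥0∞)

/-- `C` is admissible in the weighted logarithmic Hardy inequality among radial functions:
`∫ |x|^{-2(a+1)} |u|² log (|x|^{2(a_c-a)} |u|²) ≤ 2 γ log (C ∫ |x|^{-2a} |∇u|²)`
for all radial `u ∈ 𝒟_a^{1,2}(ℝ^d)` with `∫ |x|^{-2(a+1)} |u|² = 1`, in exponential form.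
(If the integrand on the left is not integrable, its integral is `-∞`, because its positive part is
always integrable, and there is nothing to require.) -/
def RadialWLHHolds (d : ℕ) (γ a C : ℝ) : Prop :=
  ∀ (u : EuclideanSpace ℝ (Fin d) → ℝ) (g : EuclideanSpace ℝ (Fin d) → EuclideanSpace ℝ (Fin d)),
    MemD12 a u g →
    (∀ x y, ‖x‖ = ‖y‖ → u x = u y) →
    ∫ x, ‖x‖ ^ (-2 * (a + 1)) * u x ^ 2 = 1 →
    Integrable (fun x => ‖x‖ ^ (-2 * (a + 1)) * u x ^ 2 *
      Real.log (‖x‖ ^ (2 * (aCrit d - a)) * u x ^ 2)) →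
    Real.exp (1 / (2 * γ) * ∫ x, ‖x‖ ^ (-2 * (a + 1)) * u x ^ 2 *
      Real.log (‖x‖ ^ (2 * (aCrit d - a)) * u x ^ 2)) ≤ C * ∫ x, ‖x‖ ^ (-2 * a) * ‖g x‖ ^ 2

/-- The optimal constant in the weighted logarithmic Hardy inequality among radial functions. -/
def CWLHRadial (d : ℕ) (γ a : ℝ) : ℝ≥0∞ :=
  ⨅ (C : ℝ≥0) (_ : RadialWLHHolds d γ a C), (C : ℝ≥0∞)

/-- `Λ_⋆ = (d-1) e (2^{d+1} π)^{-1/(d-1)} Γ(d/2)^{2/(d-1)}`. -/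
def LambdaStar (d : ℕ) : ℝ :=
  ((d : ℝ) - 1) * Real.exp 1 * (2 ^ (d + 1) * Real.pi) ^ (-1 / ((d : ℝ) - 1)) *
    Real.Gamma ((d : ℝ) / 2) ^ (2 / ((d : ℝ) - 1))

/-- `a_⋆ = a_c - √Λ_⋆`. -/
def aStar (d : ℕ) : ℝ := aCrit d - Real.sqrt (LambdaStar d)

end

/-!
The Euclidean constant. For smooth compactly supported `φ` the logarithmic Sobolev inequality on
`ℝ^d` is the Gaussian one, `Ent_γ(g) ≤ ½ ∫ |∇g|² / g dγ`, applied to `g = φ² / P + ε`, where `P` is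
the Gaussian density, in the limit `ε → 0` (`logSobolev_pi`). The Gaussian inequality tensorizes
(`gaussianPi_logSobolev`): functions bounded between positive constants, with bounded continuous
partial derivatives, keep these properties when a coordinate is integrated out. On the line it
follows from the monotone transport `T` of `g γ` to `γ`: the relation `γ(T) T' = g γ`, the bound
`log T' ≤ T' - 1` and an integration by parts of `T - x` leave a square to be completed
(`gaussian_logSobolev_normalized`). Rescaling `φ` introduces a free parameter `r`. For fixed `r` the
inequality passes to `H¹` by cutoffs and Fatou's lemma on a ball (`MemH1.logSobolev`), and the
optimal `r` gives the scale invariant form with constant `2 / (π d e)` (`lsHolds_two_div`).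
The square root of the Gaussian density gives equality (`two_div_le_of_lsHolds`).

The radial inequality. Writing `u = |x|^{-α} w(log |x|)` with `α = a_c - a`, the weighted integrals
of a radial `u` become integrals over the line, and the inequality becomes the logarithmic Sobolev
inequality on the line for `∫ w'² + α² ∫ w²`. Any admissible constant is bounded below by the value
at a Gaussian `w` (`le_of_radialWLHHolds`). For the variance that corresponds to
`t = α² / (d - 1)` this value exceeds `2 / (π d e)` as soon as `α² < Λ_⋆`
(`two_div_lt_of_lt_LambdaStar`), that is, for `a > a_⋆`.
-/

/-! ### Monotone transport between densities on the line -/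

theorem hasDerivAt_setIntegral_Iic {q : ℝ → ℝ} (hq : Continuous q) (hqi : Integrable q) (x : ℝ) :
    HasDerivAt (fun y => ∫ t in Set.Iic y, q t) (q x) x := by
  have h1 : (fun y => ∫ t in Set.Iic y, q t) =
      fun y => (∫ t in (0 : ℝ)..y, q t) + ∫ t in Set.Iic 0, q t := by
    funext y
    rw [← intervalIntegral.integral_Iic_sub_Iic hqi.integrableOn hqi.integrableOn]
    ring
  rw [h1]
  exact (intervalIntegral.integral_hasDerivAt_right (hq.intervalIntegrable _ _)
    (hq.stronglyMeasurableAtFilter _ _) hq.continuousAt).add_const _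

theorem strictMono_setIntegral_Iic {q : ℝ → ℝ} (hq : Continuous q) (hqi : Integrable q)
    (hpos : ∀ x, 0 < q x) : StrictMono fun y => ∫ t in Set.Iic y, q t :=
  strictMono_of_hasDerivAt_pos (hasDerivAt_setIntegral_Iic hq hqi) hpos

theorem tendsto_setIntegral_Iic_atTop {q : ℝ → ℝ} (hqi : Integrable q) :
    Tendsto (fun y => ∫ t in Set.Iic y, q t) atTop (𝓝 (∫ t, q t)) :=
  (aecover_Iic tendsto_id).integral_tendsto_of_countably_generated hqi

theorem tendsto_setIntegral_Iic_atBot {q : ℝ → ℝ} (hqi : Integrable q) :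
    Tendsto (fun y => ∫ t in Set.Iic y, q t) atBot (𝓝 0) := by
  have h1 : (fun y => ∫ t in Set.Iic y, q t) = fun y => (∫ t, q t) - ∫ t in Set.Ioi y, q t := by
    funext y
    rw [← intervalIntegral.integral_Iic_add_Ioi (b := y) hqi.integrableOn hqi.integrableOn]
    ring
  rw [h1]
  have h2 := (tendsto_const_nhds (x := ∫ t, q t)).sub
    ((aecover_Ioi (μ := volume) (l := atBot)
      tendsto_id).integral_tendsto_of_countably_generated hqi)
  rwa [sub_self] at h2

/-- The distribution function of a positive continuous probability density is a bijection onto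
the open unit interval. -/
theorem range_setIntegral_Iic {q : ℝ → ℝ} (hq : Continuous q) (hqi : Integrable q)
    (hpos : ∀ x, 0 < q x) (h1 : ∫ x, q x = 1) :
    Set.range (fun y => ∫ t in Set.Iic y, q t) = Set.Ioo 0 1 := by
  have hm := strictMono_setIntegral_Iic hq hqi hpos
  have hc : Continuous fun y => ∫ t in Set.Iic y, q t :=
    continuous_iff_continuousAt.2 fun x => (hasDerivAt_setIntegral_Iic hq hqi x).continuousAt
  have ht := tendsto_setIntegral_Iic_atTop hqi
  have hb := tendsto_setIntegral_Iic_atBot hqi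
  rw [h1] at ht
  apply Set.Subset.antisymm
  · rintro _ ⟨y, rfl⟩
    refine ⟨?_, ?_⟩
    · exact lt_of_le_of_lt (hm.monotone.le_of_tendsto hb (y - 1)) (hm (by linarith))
    · exact lt_of_lt_of_le (hm (show y < y + 1 by linarith)) (hm.monotone.ge_of_tendsto ht (y + 1))
  · rintro z ⟨hz0, hz1⟩
    obtain ⟨a, ha⟩ := (hb.eventually (gt_mem_nhds hz0)).exists
    obtain ⟨b, hb'⟩ := (ht.eventually (lt_mem_nhds hz1)).exists
    exact mem_range_of_exists_le_of_exists_ge hc ⟨a, ha.le⟩ ⟨b, hb'.le⟩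

/-- Monotone transport: between two positive continuous probability densities `q`, `p` there is
a differentiable `T` with `p (T x) T' x = q x`. -/
theorem exists_monotone_transport {q p : ℝ → ℝ} (hq : Continuous q) (hqi : Integrable q)
    (hqpos : ∀ x, 0 < q x) (hq1 : ∫ x, q x = 1) (hp : Continuous p) (hpi : Integrable p)
    (hppos : ∀ x, 0 < p x) (hp1 : ∫ x, p x = 1) :
    ∃ T : ℝ → ℝ, ∀ x, HasDerivAt T (q x / p (T x)) x := by
  set F := fun y => ∫ t in Set.Iic y, q t with hF
  set H := fun y => ∫ t in Set.Iic y, p t with hH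
  have hFr : Set.range F = Set.Ioo 0 1 := range_setIntegral_Iic hq hqi hqpos hq1
  have hHr : Set.range H = Set.Ioo 0 1 := range_setIntegral_Iic hp hpi hppos hp1
  have hFm : StrictMono F := strictMono_setIntegral_Iic hq hqi hqpos
  have hHm : StrictMono H := strictMono_setIntegral_Iic hp hpi hppos
  have hex : ∀ x, ∃ y, H y = F x := fun x => by
    have : F x ∈ Set.range H := by rw [hHr, ← hFr]; exact ⟨x, rfl⟩
    exact this
  choose T hT using hex
  have hTm : StrictMono T := fun x y hxy => by
    rw [← hHm.lt_iff_lt, hT, hT]; exact hFm hxy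
  have hTs : Function.Surjective T := fun y => by
    have : H y ∈ Set.range F := by rw [hFr, ← hHr]; exact ⟨y, rfl⟩
    obtain ⟨x, hx⟩ := this
    exact ⟨x, hHm.injective (by rw [hT, hx])⟩
  have hTc : Continuous T := hTm.monotone.continuous_of_surjective hTs
  refine ⟨T, fun x => ?_⟩
  rw [hasDerivAt_iff_tendsto_slope]
  have hF' : Tendsto (slope F x) (𝓝[≠] x) (𝓝 (q x)) :=
    hasDerivAt_iff_tendsto_slope.1 (hasDerivAt_setIntegral_Iic hq hqi x)
  have hH' : Tendsto (fun y => slope H (T x) (T y)) (𝓝[≠] x) (𝓝 (p (T x))) := by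
    refine (hasDerivAt_iff_tendsto_slope.1 (hasDerivAt_setIntegral_Iic hp hpi (T x))).comp ?_
    refine tendsto_nhdsWithin_iff.2 ⟨(hTc.tendsto x).mono_left nhdsWithin_le_nhds, ?_⟩
    filter_upwards [self_mem_nhdsWithin] with y hy
    exact fun h => hy (hTm.injective h)
  refine (hF'.div hH' (hppos _).ne').congr' ?_
  filter_upwards [self_mem_nhdsWithin] with y hy
  have h1 : T y - T x ≠ 0 := sub_ne_zero.2 fun h => hy (hTm.injective h)
  have h2 : y - x ≠ 0 := sub_ne_zero.2 hy
  have h3 : F y - F x ≠ 0 := sub_ne_zero.2 fun h => hy (hFm.injective h)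
  simp only [slope_def_field, Pi.div_apply, hT]
  field_simp

/-- A nonnegative continuous function with bounded integrals over `[0, R]` is frequently small. -/
theorem frequently_lt_of_integral_le {f : ℝ → ℝ} (hf : Continuous f) (hf0 : ∀ x, 0 ≤ f x) {C : ℝ}
    (hC : ∀ R, 0 ≤ R → ∫ x in (0 : ℝ)..R, f x ≤ C) {δ : ℝ} (hδ : 0 < δ) :
    ∃ᶠ x in atTop, f x < δ := by
  intro h
  obtain ⟨N, hN⟩ := eventually_atTop.1 h
  set N' := max N 0 with hN'
  have hC0 : 0 ≤ C := by simpa using hC 0 le_rfl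
  set R := N' + (C + 1) / δ with hR
  have hNR : N' ≤ R := by rw [hR]; have : 0 ≤ (C + 1) / δ := by positivity
                          linarith
  have hN0 : 0 ≤ N' := le_max_right _ _
  have h1 : ∫ x in N'..R, δ ≤ ∫ x in N'..R, f x := by
    refine intervalIntegral.integral_mono_on hNR (by simp) (hf.intervalIntegrable _ _) ?_
    intro x hx
    exact not_lt.1 (hN x (le_trans (le_max_left _ _) hx.1))
  have h2 : ∫ x in (0 : ℝ)..R, f x = (∫ x in (0 : ℝ)..N', f x) + ∫ x in N'..R, f x :=
    (intervalIntegral.integral_add_adjacent_intervals (hf.intervalIntegrable _ _)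
      (hf.intervalIntegrable _ _)).symm
  have h3 : 0 ≤ ∫ x in (0 : ℝ)..N', f x :=
    intervalIntegral.integral_nonneg hN0 fun x _ => hf0 x
  have h4 := hC R (hN0.trans hNR)
  rw [intervalIntegral.integral_const, smul_eq_mul] at h1
  have h5 : (R - N') * δ = C + 1 := by rw [hR]; field_simp; ring
  linarith

/-! ### The Gaussian logarithmic Sobolev inequality on the line -/

theorem gaussianPDFReal_zero_one (x : ℝ) :
    ProbabilityTheory.gaussianPDFReal 0 1 x = (√(2 * Real.pi))⁻¹ * Real.exp (-x ^ 2 / 2) := by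
  simp [ProbabilityTheory.gaussianPDFReal]

theorem continuous_gaussianPDFReal_zero_one :
    Continuous (ProbabilityTheory.gaussianPDFReal 0 1) := by
  have : ProbabilityTheory.gaussianPDFReal 0 1 =
      fun x => (√(2 * Real.pi))⁻¹ * Real.exp (-x ^ 2 / 2) := funext gaussianPDFReal_zero_one
  rw [this]; fun_prop

theorem hasDerivAt_gaussianPDFReal_zero_one (x : ℝ) :
    HasDerivAt (ProbabilityTheory.gaussianPDFReal 0 1)
      (-x * ProbabilityTheory.gaussianPDFReal 0 1 x) x := by
  have : ProbabilityTheory.gaussianPDFReal 0 1 =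
      fun x => (√(2 * Real.pi))⁻¹ * Real.exp (-x ^ 2 / 2) := funext gaussianPDFReal_zero_one
  rw [this]
  have h : HasDerivAt (fun x : ℝ => -x ^ 2 / 2) (-x) x := by
    exact ((hasDerivAt_pow 2 x).neg.div_const 2).congr_deriv (by push_cast; ring)
  exact (h.exp.const_mul _).congr_deriv (by ring)

theorem log_gaussianPDFReal_zero_one (x : ℝ) :
    Real.log (ProbabilityTheory.gaussianPDFReal 0 1 x) =
      -(Real.log (2 * Real.pi) / 2) - x ^ 2 / 2 := by
  rw [gaussianPDFReal_zero_one, Real.log_mul (by positivity) (Real.exp_pos _).ne', Real.log_exp,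
    Real.log_inv, Real.log_sqrt (by positivity)]
  ring

theorem integrable_sq_mul_gaussianPDFReal :
    Integrable (fun x => x ^ 2 * ProbabilityTheory.gaussianPDFReal 0 1 x) := by
  have h := (integrable_rpow_mul_exp_neg_mul_sq (b := 1 / 2) (by norm_num)
    (s := 2) (by norm_num)).const_mul (√(2 * Real.pi))⁻¹
  refine h.congr (Eventually.of_forall fun x => ?_)
  simp only [gaussianPDFReal_zero_one]
  rw [Real.rpow_two]
  ring_nf

theorem integral_sq_mul_gaussianPDFReal :
    ∫ x, x ^ 2 * ProbabilityTheory.gaussianPDFReal 0 1 x = 1 := by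
  have h := ProbabilityTheory.variance_fun_id_gaussianReal (μ := 0) (v := 1)
  rw [ProbabilityTheory.variance_eq_integral (by fun_prop)] at h
  rw [ProbabilityTheory.integral_gaussianReal_eq_integral_smul one_ne_zero] at h
  simp only [ProbabilityTheory.integral_id_gaussianReal, sub_zero, smul_eq_mul, NNReal.coe_one] at h
  rw [← h]
  congr 1; ext x; ring

/-- If `T` transports `q` to a density `p` then second moments of `T` with respect to `q` are
bounded by second moments of `p`. -/
theorem integral_transport_sq_le {q p T : ℝ → ℝ} (hq : Continuous q) (hqpos : ∀ x, 0 < q x)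
    (hp : Continuous p) (hppos : ∀ x, 0 < p x) (hT : ∀ x, HasDerivAt T (q x / p (T x)) x)
    (hp2 : Integrable fun x => x ^ 2 * p x) (R : ℝ) (hR : 0 ≤ R) :
    ∫ x in (-R)..R, T x ^ 2 * q x ≤ ∫ x, x ^ 2 * p x := by
  have hTc : Continuous T := continuous_iff_continuousAt.2 fun x => (hT x).continuousAt
  have hT'c : Continuous fun x => q x / p (T x) :=
    hq.div (hp.comp hTc) fun x => (hppos _).ne'
  have hf : Continuous fun y => y ^ 2 * p y := (continuous_pow 2).mul hp
  have h1 := intervalIntegral.integral_comp_mul_deriv (a := -R) (b := R) (f := T)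
    (g := fun y => y ^ 2 * p y) (fun x _ => hT x) hT'c.continuousOn hf
  have h2 : ∀ x, ((fun y => y ^ 2 * p y) ∘ T) x * (q x / p (T x)) = T x ^ 2 * q x := fun x => by
    have := (hppos (T x)).ne'
    simp only [Function.comp]; field_simp
  simp only [h2] at h1
  rw [h1]
  have hTm : Monotone T :=
    monotone_of_hasDerivAt_nonneg hT fun x => (div_pos (hqpos x) (hppos _)).le
  rw [intervalIntegral.integral_of_le (hTm (by linarith))]
  exact setIntegral_le_integral hp2
    (Eventually.of_forall fun x => mul_nonneg (sq_nonneg _) (hppos x).le)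

theorem integrable_bdd_mul_gaussianPDFReal {f : ℝ → ℝ} (hf : Continuous f) {C : ℝ}
    (hC : ∀ x, |f x| ≤ C) :
    Integrable fun x => f x * ProbabilityTheory.gaussianPDFReal 0 1 x :=
  (ProbabilityTheory.integrable_gaussianPDFReal 0 1).bdd_mul hf.aestronglyMeasurable
    (Eventually.of_forall fun x => by simpa using hC x)

theorem abs_mul_log_le {t ε M : ℝ} (hε : 0 < ε) (h1 : ε ≤ t) (h2 : t ≤ M) :
    |t * Real.log t| ≤ M * (|Real.log ε| + |Real.log M|) := by
  have ht : 0 < t := hε.trans_le h1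
  rw [abs_mul, abs_of_pos ht]
  have h3 : |Real.log t| ≤ |Real.log ε| + |Real.log M| := by
    have a1 := Real.log_le_log hε h1
    have a2 := Real.log_le_log ht h2
    rw [abs_le]
    constructor
    · linarith [neg_abs_le (Real.log ε), abs_nonneg (Real.log M)]
    · linarith [le_abs_self (Real.log M), abs_nonneg (Real.log ε)]
  exact mul_le_mul h2 h3 (abs_nonneg _) (ht.le.trans h2)

theorem abs_sq_div_le {t s ε L : ℝ} (hε : 0 < ε) (h1 : ε ≤ t) (h2 : |s| ≤ L) :
    |s ^ 2 / t| ≤ L ^ 2 / ε := by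
  have ht : 0 < t := hε.trans_le h1
  rw [abs_div, abs_of_pos ht, abs_pow]
  have := abs_nonneg s
  gcongr

/-- The Gaussian inequality on the line for a probability density `g`. With the transport `T` of
`g p` to `p` and `θ = T - x`, the entropy density is at most `(g p θ)' + p g'² / (2 g)`. The
boundary terms vanish along a sequence because `θ` has a finite first moment. -/
theorem gaussian_logSobolev_normalized {g g' : ℝ → ℝ} (hg : ∀ x, HasDerivAt g (g' x) x)
    (hg' : Continuous g') {ε M L : ℝ} (hε : 0 < ε) (h1 : ∀ x, ε ≤ g x) (h2 : ∀ x, g x ≤ M)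
    (h3 : ∀ x, |g' x| ≤ L)
    (hint : ∫ x, g x * ProbabilityTheory.gaussianPDFReal 0 1 x = 1) :
    ∫ x, g x * Real.log (g x) * ProbabilityTheory.gaussianPDFReal 0 1 x ≤
      1 / 2 * ∫ x, g' x ^ 2 / g x * ProbabilityTheory.gaussianPDFReal 0 1 x := by
  set p := ProbabilityTheory.gaussianPDFReal 0 1 with hp
  have hpc : Continuous p := continuous_gaussianPDFReal_zero_one
  have hppos : ∀ x, 0 < p x := fun x => ProbabilityTheory.gaussianPDFReal_pos 0 1 x one_ne_zero
  have hpi : Integrable p := ProbabilityTheory.integrable_gaussianPDFReal 0 1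
  have hp1 : ∫ x, p x = 1 := ProbabilityTheory.integral_gaussianPDFReal_eq_one 0 one_ne_zero
  have hgc : Continuous g := continuous_iff_continuousAt.2 fun x => (hg x).continuousAt
  have hgpos : ∀ x, 0 < g x := fun x => hε.trans_le (h1 x)
  have hM : 0 < M := (hgpos 0).trans_le (h2 0)
  set q : ℝ → ℝ := fun x => g x * p x with hq
  have hqc : Continuous q := hgc.mul hpc
  have hqpos : ∀ x, 0 < q x := fun x => mul_pos (hgpos x) (hppos x)
  have hqi : Integrable q := integrable_bdd_mul_gaussianPDFReal hgc
    (C := M) fun x => by rw [abs_of_pos (hgpos x)]; exact h2 x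
  obtain ⟨T, hT⟩ := exists_monotone_transport hqc hqi hqpos hint hpc hpi hppos hp1
  have hTc : Continuous T := continuous_iff_continuousAt.2 fun x => (hT x).continuousAt
  have hT'c : Continuous fun x => q x / p (T x) :=
    hqc.div (hpc.comp hTc) fun x => (hppos _).ne'
  set θ : ℝ → ℝ := fun x => T x - x with hθ
  have hθc : Continuous θ := hTc.sub continuous_id
  set Q' : ℝ → ℝ := fun x => (g' x * p x + g x * (-x * p x)) * θ x + q x * (q x / p (T x) - 1)
    with hQ'
  have hQ : ∀ x, HasDerivAt (fun x => q x * θ x) (Q' x) x := fun x =>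
    ((hg x).mul (hasDerivAt_gaussianPDFReal_zero_one x)).mul ((hT x).sub (hasDerivAt_id x))
  have hQ'c : Continuous Q' := by
    have : Continuous fun x => q x / p (T x) - 1 := hT'c.sub continuous_const
    fun_prop
  -- the pointwise inequality: `log T' ≤ T' - 1` and completion of the square
  have key : ∀ x, g x * Real.log (g x) * p x ≤ Q' x + 1 / 2 * (g' x ^ 2 / g x * p x) := by
    intro x
    have hT'pos : 0 < q x / p (T x) := div_pos (hqpos x) (hppos _)
    have e1 : Real.log (q x / p (T x)) =
        Real.log (g x) + Real.log (p x) - Real.log (p (T x)) := by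
      rw [Real.log_div (hqpos x).ne' (hppos _).ne', hq,
        Real.log_mul (hgpos x).ne' (hppos x).ne']
    rw [hp, log_gaussianPDFReal_zero_one, log_gaussianPDFReal_zero_one, ← hp] at e1
    have e2 := Real.log_le_sub_one_of_pos hT'pos
    have e3 : Real.log (g x) ≤ x ^ 2 / 2 - T x ^ 2 / 2 + (q x / p (T x) - 1) := by linarith
    have e4 : g x * Real.log (g x) * p x ≤
        q x * (x ^ 2 / 2 - T x ^ 2 / 2 + (q x / p (T x) - 1)) := by
      have := mul_le_mul_of_nonneg_left e3 (hqpos x).le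
      calc _ = q x * Real.log (g x) := by rw [hq]; ring
        _ ≤ _ := this
    have e5 : 0 ≤ p x / (2 * g x) * (g' x + g x * θ x) ^ 2 := by
      have := hgpos x; have := hppos x; positivity
    have e6 : p x / (2 * g x) * (g' x + g x * θ x) ^ 2 =
        1 / 2 * (g' x ^ 2 / g x * p x) + p x * g' x * θ x + g x * p x * θ x ^ 2 / 2 := by
      have := (hgpos x).ne'
      field_simp; ring
    have e7 : q x * (x ^ 2 / 2 - T x ^ 2 / 2 + (q x / p (T x) - 1)) =
        Q' x - p x * g' x * θ x - g x * p x * θ x ^ 2 / 2 := by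
      simp only [hQ', hθ]
      have : q x = g x * p x := rfl
      generalize q x / p (T x) = τ
      rw [this]; ring
    linarith
  have hentc : Continuous fun x => g x * Real.log (g x) * p x :=
    (hgc.mul (hgc.log fun x => (hgpos x).ne')).mul hpc
  have hent : Integrable fun x => g x * Real.log (g x) * p x :=
    integrable_bdd_mul_gaussianPDFReal (hgc.mul (hgc.log fun x => (hgpos x).ne'))
      fun x => abs_mul_log_le hε (h1 x) (h2 x)
  have hfisc : Continuous fun x => g' x ^ 2 / g x * p x :=
    ((hg'.pow 2).div hgc fun x => (hgpos x).ne').mul hpc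
  have hfis : Integrable fun x => g' x ^ 2 / g x * p x :=
    integrable_bdd_mul_gaussianPDFReal ((hg'.pow 2).div hgc fun x => (hgpos x).ne')
      fun x => abs_sq_div_le hε (h1 x) (h3 x)
  have hfis0 : ∀ x, 0 ≤ g' x ^ 2 / g x * p x := fun x => by
    have := hgpos x; have := hppos x; positivity
  -- the boundary terms at `±R` are small for suitable arbitrarily large `R`
  set b : ℝ → ℝ := fun x => q x * |θ x| + q (-x) * |θ (-x)| with hb
  have hbc : Continuous b := by fun_prop
  have hb0 : ∀ x, 0 ≤ b x := fun x =>
    add_nonneg (mul_nonneg (hqpos _).le (abs_nonneg _)) (mul_nonneg (hqpos _).le (abs_nonneg _))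
  have hbint : ∀ R, 0 ≤ R → ∫ x in (0 : ℝ)..R, b x ≤ 1 + M + 1 := by
    intro R hR
    have c1 : Continuous fun x => q x * |θ x| := by fun_prop
    have i1 : ∫ x in (0 : ℝ)..R, b x = ∫ x in (-R)..R, q x * |θ x| := by
      rw [hb, intervalIntegral.integral_add (c1.intervalIntegrable _ _)
        (Continuous.intervalIntegrable (by fun_prop) _ _),
        intervalIntegral.integral_comp_neg (fun x => q x * |θ x|), neg_zero, add_comm,
        intervalIntegral.integral_add_adjacent_intervals (c1.intervalIntegrable _ _)
        (c1.intervalIntegrable _ _)]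
    rw [i1]
    have c2 : Continuous fun x => q x + M * (x ^ 2 * p x) := by fun_prop
    have c3 : Continuous fun x => T x ^ 2 * q x := by fun_prop
    have hx2 := integrable_sq_mul_gaussianPDFReal
    have i2 : ∫ x in (-R)..R, q x * |θ x| ≤
        ∫ x in (-R)..R, ((q x + M * (x ^ 2 * p x)) + T x ^ 2 * q x) := by
      refine intervalIntegral.integral_mono_on (by linarith) (c1.intervalIntegrable _ _)
        ((c2.add c3).intervalIntegrable _ _) fun x _ => ?_
      have a1 : |θ x| ≤ 1 + x ^ 2 + T x ^ 2 := by
        rw [abs_le]; constructor <;> simp only [hθ] <;>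
        nlinarith [sq_nonneg (x - 1 / 2), sq_nonneg (x + 1 / 2), sq_nonneg (T x - 1 / 2),
          sq_nonneg (T x + 1 / 2)]
      have a2 : q x * x ^ 2 ≤ M * (x ^ 2 * p x) := by
        have : g x * (x ^ 2 * p x) ≤ M * (x ^ 2 * p x) :=
          mul_le_mul_of_nonneg_right (h2 x) (mul_nonneg (sq_nonneg _) (hppos x).le)
        calc q x * x ^ 2 = g x * (x ^ 2 * p x) := by rw [hq]; ring
          _ ≤ _ := this
      have a3 := mul_le_mul_of_nonneg_left a1 (hqpos x).le
      nlinarith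
    have i3 : ∫ x in (-R)..R, (q x + M * (x ^ 2 * p x)) ≤ 1 + M := by
      rw [intervalIntegral.integral_of_le (by linarith)]
      have i : Integrable fun x => q x + M * (x ^ 2 * p x) := hqi.add (hx2.const_mul M)
      refine (setIntegral_le_integral i (Eventually.of_forall fun x =>
        add_nonneg (hqpos x).le (mul_nonneg hM.le
          (mul_nonneg (sq_nonneg _) (hppos x).le)))).trans_eq ?_
      rw [integral_add hqi (hx2.const_mul M), integral_const_mul, hint,
        integral_sq_mul_gaussianPDFReal, mul_one]
    have i4 := integral_transport_sq_le hqc hqpos hpc hppos hT hx2 R hR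
    rw [integral_sq_mul_gaussianPDFReal] at i4
    rw [intervalIntegral.integral_add (c2.intervalIntegrable _ _)
      (c3.intervalIntegrable _ _)] at i2
    linarith
  have hlim : Tendsto (fun R => ∫ x in (-R)..R, g x * Real.log (g x) * p x) atTop
      (𝓝 (∫ x, g x * Real.log (g x) * p x)) :=
    intervalIntegral_tendsto_integral hent tendsto_neg_atTop_atBot tendsto_id
  refine le_of_forall_pos_le_add fun δ hδ => ?_
  refine le_of_tendsto_of_frequently hlim ?_
  refine ((frequently_lt_of_integral_le hbc hb0 hbint hδ).and_eventually
    (eventually_ge_atTop 0)).mono ?_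
  rintro R ⟨hbR, hR⟩
  have j1 : ∫ x in (-R)..R, g x * Real.log (g x) * p x ≤
      ∫ x in (-R)..R, (Q' x + 1 / 2 * (g' x ^ 2 / g x * p x)) :=
    intervalIntegral.integral_mono_on (by linarith) (hentc.intervalIntegrable _ _)
      ((hQ'c.add (continuous_const.mul hfisc)).intervalIntegrable _ _) fun x _ => key x
  rw [intervalIntegral.integral_add (hQ'c.intervalIntegrable _ _)
    (Continuous.intervalIntegrable (by fun_prop) _ _),
    intervalIntegral.integral_eq_sub_of_hasDerivAt (fun x _ => hQ x)
      (hQ'c.intervalIntegrable _ _), intervalIntegral.integral_const_mul] at j1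
  have j2 : ∫ x in (-R)..R, g' x ^ 2 / g x * p x ≤ ∫ x, g' x ^ 2 / g x * p x := by
    rw [intervalIntegral.integral_of_le (by linarith)]
    exact setIntegral_le_integral hfis (Eventually.of_forall hfis0)
  have j3 : q R * θ R - q (-R) * θ (-R) ≤ b R := by
    have a1 := mul_le_mul_of_nonneg_left (le_abs_self (θ R)) (hqpos R).le
    have a2 := mul_le_mul_of_nonneg_left (neg_abs_le (θ (-R))) (hqpos (-R)).le
    simp only [hb]; linarith
  linarith

/-- The logarithmic Sobolev inequality for the standard Gaussian measure on the line. -/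
theorem gaussian_logSobolev {g g' : ℝ → ℝ} (hg : ∀ x, HasDerivAt g (g' x) x)
    (hg' : Continuous g') {ε M L : ℝ} (hε : 0 < ε) (h1 : ∀ x, ε ≤ g x) (h2 : ∀ x, g x ≤ M)
    (h3 : ∀ x, |g' x| ≤ L) :
    ∫ x, g x * Real.log (g x) ∂(ProbabilityTheory.gaussianReal 0 1) -
      (∫ x, g x ∂(ProbabilityTheory.gaussianReal 0 1)) *
        Real.log (∫ x, g x ∂(ProbabilityTheory.gaussianReal 0 1)) ≤
      1 / 2 * ∫ x, g' x ^ 2 / g x ∂(ProbabilityTheory.gaussianReal 0 1) := by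
  have hgc : Continuous g := continuous_iff_continuousAt.2 fun x => (hg x).continuousAt
  have hgpos : ∀ x, 0 < g x := fun x => hε.trans_le (h1 x)
  simp only [ProbabilityTheory.integral_gaussianReal_eq_integral_smul one_ne_zero, smul_eq_mul]
  simp only [mul_comm (ProbabilityTheory.gaussianPDFReal 0 1 _)]
  set p := ProbabilityTheory.gaussianPDFReal 0 1 with hp
  have hpi : Integrable p := ProbabilityTheory.integrable_gaussianPDFReal 0 1
  have hp1 : ∫ x, p x = 1 := ProbabilityTheory.integral_gaussianPDFReal_eq_one 0 one_ne_zero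
  have hp0 : ∀ x, 0 ≤ p x := fun x => ProbabilityTheory.gaussianPDFReal_nonneg 0 1 x
  have hgi : Integrable fun x => g x * p x := integrable_bdd_mul_gaussianPDFReal hgc
    (C := M) fun x => by rw [abs_of_pos (hgpos x)]; exact h2 x
  have hent : Integrable fun x => g x * Real.log (g x) * p x :=
    integrable_bdd_mul_gaussianPDFReal (hgc.mul (hgc.log fun x => (hgpos x).ne'))
      fun x => abs_mul_log_le hε (h1 x) (h2 x)
  set m := ∫ x, g x * p x with hm
  have hmpos : 0 < m := by
    refine hε.trans_le ?_
    calc ε = ∫ x, ε * p x := by rw [integral_const_mul, hp1, mul_one]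
      _ ≤ m := integral_mono (hpi.const_mul ε) hgi
        fun x => mul_le_mul_of_nonneg_right (h1 x) (hp0 x)
  have := gaussian_logSobolev_normalized (g := fun x => g x / m) (g' := fun x => g' x / m)
    (fun x => (hg x).div_const m) (hg'.div_const m) (ε := ε / m) (M := M / m) (L := L / m)
    (by positivity) (fun x => by have := h1 x; gcongr) (fun x => by have := h2 x; gcongr)
    (fun x => by rw [abs_div, abs_of_pos hmpos]; have := h3 x; gcongr) (by
      have : (fun x => g x / m * ProbabilityTheory.gaussianPDFReal 0 1 x) =
        fun x => (g x * p x) / m := by ext x; rw [← hp]; ring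
      rw [this, integral_div, ← hm, div_self hmpos.ne'])
  rw [← hp] at this
  have e1 : ∀ x, g x / m * Real.log (g x / m) * p x =
      (g x * Real.log (g x) * p x - Real.log m * (g x * p x)) / m := fun x => by
    rw [Real.log_div (hgpos x).ne' hmpos.ne']; ring
  have e2 : ∀ x, (g' x / m) ^ 2 / (g x / m) * p x = (g' x ^ 2 / g x * p x) / m := fun x => by
    have := (hgpos x).ne'
    field_simp
  simp only [e1, e2] at this
  rw [integral_div, integral_div, integral_sub hent (hgi.const_mul _), integral_const_mul,
    ← hm, div_le_iff₀ hmpos] at this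
  have e3 : 1 / 2 * ((∫ x, g' x ^ 2 / g x * p x) / m) * m =
      1 / 2 * ∫ x, g' x ^ 2 / g x * p x := by
    rw [mul_assoc, div_mul_cancel₀ _ hmpos.ne']
  linarith

/-! ### Tensorization of the Gaussian logarithmic Sobolev inequality -/

/-- The standard Gaussian measure on `Fin n → ℝ`. -/
noncomputable abbrev gaussianPi (n : ℕ) : Measure (Fin n → ℝ) :=
  Measure.pi fun _ => ProbabilityTheory.gaussianReal 0 1

/-- `g` takes values in `[ε, M]`, `ε > 0`, and has the continuous partial derivatives `D i`, all
bounded by `M`. The class is stable under integrating out a coordinate. -/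
structure HasBoundedPartials {n : ℕ} (g : (Fin n → ℝ) → ℝ) (D : Fin n → (Fin n → ℝ) → ℝ)
    (ε M : ℝ) : Prop where
  pos : 0 < ε
  hasDerivAt : ∀ i x, HasDerivAt (fun t => g (Function.update x i t)) (D i x) (x i)
  continuous_fun : Continuous g
  continuous_partial : ∀ i, Continuous (D i)
  lower : ∀ x, ε ≤ g x
  upper : ∀ x, g x ≤ M
  bound : ∀ i x, |D i x| ≤ M

theorem integrable_of_continuous_bdd {X : Type*} [TopologicalSpace X] [MeasurableSpace X]
    [OpensMeasurableSpace X] [SecondCountableTopologyEither X ℝ] {μ : Measure X}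
    [IsFiniteMeasure μ] {f : X → ℝ} (hf : Continuous f) {C : ℝ} (hC : ∀ x, |f x| ≤ C) :
    Integrable f μ :=
  Integrable.of_bound hf.aestronglyMeasurable C (Eventually.of_forall hC)

theorem continuous_finCons {n : ℕ} :
    Continuous fun z : ℝ × (Fin n → ℝ) => (Fin.cons z.1 z.2 : Fin (n + 1) → ℝ) := by
  refine continuous_pi fun i => ?_
  refine Fin.cases ?_ (fun j => ?_) i
  · simpa using continuous_fst
  · simpa [Function.comp_def] using (continuous_apply j).comp continuous_snd

theorem continuous_finCons_left {n : ℕ} (y : Fin n → ℝ) :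
    Continuous fun t : ℝ => (Fin.cons t y : Fin (n + 1) → ℝ) :=
  continuous_finCons.comp (by fun_prop : Continuous fun t : ℝ => (t, y))

theorem continuous_finCons_right {n : ℕ} (t : ℝ) :
    Continuous fun y : Fin n → ℝ => (Fin.cons t y : Fin (n + 1) → ℝ) :=
  continuous_finCons.comp (by fun_prop : Continuous fun y : Fin n → ℝ => (t, y))

theorem integral_gaussianPi_succ {n : ℕ} {f : (Fin (n + 1) → ℝ) → ℝ} (hf : Continuous f) {C : ℝ}
    (hC : ∀ x, |f x| ≤ C) :
    ∫ x, f x ∂(gaussianPi (n + 1)) =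
      ∫ t, ∫ y, f (Fin.cons t y) ∂(gaussianPi n) ∂(ProbabilityTheory.gaussianReal 0 1) := by
  have h := (measurePreserving_piFinSuccAbove
    (fun _ : Fin (n + 1) => ProbabilityTheory.gaussianReal 0 1) 0).symm
  rw [← h.integral_comp' f]
  rw [integral_prod]
  · simp [MeasurableEquiv.piFinSuccAbove, Fin.insertNth_zero', Fin.insertNthEquiv]
  · refine integrable_of_continuous_bdd (C := C) ?_ fun x => hC _
    have : (fun z => f ((MeasurableEquiv.piFinSuccAbove (fun _ : Fin (n + 1) => ℝ) 0).symm z)) =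
        fun z : ℝ × (Fin n → ℝ) => f (Fin.cons z.1 z.2) := by
      ext z; simp [MeasurableEquiv.piFinSuccAbove, Fin.insertNth_zero', Fin.insertNthEquiv]
    rw [this]
    exact hf.comp continuous_finCons

theorem continuous_integral_finCons {n : ℕ} {f : (Fin (n + 1) → ℝ) → ℝ} (hf : Continuous f) {C : ℝ}
    (hC : ∀ x, |f x| ≤ C) :
    Continuous fun t => ∫ y, f (Fin.cons t y) ∂(gaussianPi n) :=
  continuous_of_dominated (bound := fun _ => C)
    (fun t => (hf.comp (continuous_finCons_right t)).aestronglyMeasurable)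
    (fun _ => Eventually.of_forall fun _ => hC _) (integrable_const C)
    (Eventually.of_forall fun y => hf.comp (continuous_finCons_left y))

theorem abs_integral_le_of_bdd {X : Type*} [MeasurableSpace X] {μ : Measure X}
    [IsProbabilityMeasure μ] {f : X → ℝ} {C : ℝ} (hC : ∀ x, |f x| ≤ C) : |∫ x, f x ∂μ| ≤ C := by
  simpa using norm_integral_le_of_norm_le_const (μ := μ) (f := f) (Eventually.of_forall hC)

/-- Cauchy–Schwarz in the form `(∫ D)² / ∫ g ≤ ∫ D² / g`. -/
theorem sq_integral_div_le {X : Type*} [MeasurableSpace X] {μ : Measure X} {g D : X → ℝ}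
    (hg : Integrable g μ) (hD : Integrable D μ) (hq : Integrable (fun x => D x ^ 2 / g x) μ)
    (hpos : ∀ x, 0 < g x) (hint : 0 < ∫ x, g x ∂μ) :
    (∫ x, D x ∂μ) ^ 2 / ∫ x, g x ∂μ ≤ ∫ x, D x ^ 2 / g x ∂μ := by
  set c := (∫ x, D x ∂μ) / ∫ x, g x ∂μ with hc
  have h1 : 0 ≤ ∫ x, (D x ^ 2 / g x - 2 * c * D x + c ^ 2 * g x) ∂μ := by
    refine integral_nonneg fun x => ?_
    have : D x ^ 2 / g x - 2 * c * D x + c ^ 2 * g x = (D x - c * g x) ^ 2 / g x := by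
      have := (hpos x).ne'
      field_simp; ring
    simp only [Pi.zero_apply]
    rw [this]
    exact div_nonneg (sq_nonneg _) (hpos x).le
  rw [integral_add (f := fun x => D x ^ 2 / g x - 2 * c * D x) (hq.sub (hD.const_mul _))
    (hg.const_mul _), integral_sub hq (hD.const_mul _),
    integral_const_mul, integral_const_mul] at h1
  have h2 : (∫ x, D x ∂μ) ^ 2 / ∫ x, g x ∂μ =
      2 * c * (∫ x, D x ∂μ) - c ^ 2 * ∫ x, g x ∂μ := by
    rw [hc]; field_simp; ring
  linarith

theorem HasBoundedPartials.slice {n : ℕ} {g : (Fin (n + 1) → ℝ) → ℝ}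
    {D : Fin (n + 1) → (Fin (n + 1) → ℝ) → ℝ} {ε M : ℝ} (h : HasBoundedPartials g D ε M) (t : ℝ) :
    HasBoundedPartials (fun y => g (Fin.cons t y)) (fun i y => D i.succ (Fin.cons t y)) ε M where
  pos := h.pos
  hasDerivAt i y := by
    have := h.hasDerivAt i.succ (Fin.cons t y)
    simpa [← Fin.cons_update] using this
  continuous_fun := h.continuous_fun.comp (continuous_finCons_right t)
  continuous_partial i := (h.continuous_partial i.succ).comp (continuous_finCons_right t)
  lower _ := h.lower _
  upper _ := h.upper _
  bound _ _ := h.bound _ _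

/-- Differentiation under the integral sign for the first marginal. -/
theorem HasBoundedPartials.hasDerivAt_marginal {n : ℕ} {g : (Fin (n + 1) → ℝ) → ℝ}
    {D : Fin (n + 1) → (Fin (n + 1) → ℝ) → ℝ} {ε M : ℝ} (h : HasBoundedPartials g D ε M) (t : ℝ) :
    HasDerivAt (fun s => ∫ y, g (Fin.cons s y) ∂(gaussianPi n))
      (∫ y, D 0 (Fin.cons t y) ∂(gaussianPi n)) t := by
  refine (hasDerivAt_integral_of_dominated_loc_of_deriv_le (s := Set.univ)
    (F := fun s y => g (Fin.cons s y)) (F' := fun s y => D 0 (Fin.cons s y))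
    (bound := fun _ => M) Filter.univ_mem
    (Eventually.of_forall fun s =>
      (h.continuous_fun.comp (continuous_finCons_right s)).aestronglyMeasurable) ?_
    ((h.continuous_partial 0).comp (continuous_finCons_right t)).aestronglyMeasurable
    (Eventually.of_forall fun y s _ => h.bound 0 _) (integrable_const M)
    (Eventually.of_forall fun y s _ => ?_)).2
  · refine integrable_of_continuous_bdd (C := M)
      (h.continuous_fun.comp (continuous_finCons_right t)) fun y => ?_
    rw [abs_of_pos (h.pos.trans_le (h.lower _))]
    exact h.upper _
  · have := h.hasDerivAt 0 (Fin.cons s y)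
    simpa [Fin.update_cons_zero] using this

/-- The logarithmic Sobolev inequality for the standard Gaussian measure on `Fin n → ℝ`, by
induction on the dimension: the entropy of `g` is the entropy of the first marginal `F` plus the
mean entropy of the slices of `g`, and `F' ^ 2 / F` is at most the mean of `(∂₀ g) ^ 2 / g`. -/
theorem gaussianPi_logSobolev {n : ℕ} {g : (Fin n → ℝ) → ℝ} {D : Fin n → (Fin n → ℝ) → ℝ}
    {ε M : ℝ} (h : HasBoundedPartials g D ε M) :
    ∫ x, g x * Real.log (g x) ∂(gaussianPi n) -
      (∫ x, g x ∂(gaussianPi n)) * Real.log (∫ x, g x ∂(gaussianPi n)) ≤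
      1 / 2 * ∫ x, ∑ i, D i x ^ 2 / g x ∂(gaussianPi n) := by
  induction n with
  | zero =>
    have e : ∀ f : (Fin 0 → ℝ) → ℝ, ∫ x, f x ∂(gaussianPi 0) = f 0 := fun f => by
      have : f = fun _ => f 0 := by ext x; rw [Subsingleton.elim x 0]
      rw [this]; simp
    rw [e, e, e]; simp
  | succ n ih =>
    have hpos : ∀ x, 0 < g x := fun x => h.pos.trans_le (h.lower x)
    have hcg := h.continuous_fun
    have hgb : ∀ x, |g x| ≤ M := fun x => by rw [abs_of_pos (hpos x)]; exact h.upper x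
    have hec : Continuous fun x => g x * Real.log (g x) :=
      hcg.mul (hcg.log fun x => (hpos x).ne')
    have heb : ∀ x, |g x * Real.log (g x)| ≤ M * (|Real.log ε| + |Real.log M|) :=
      fun x => abs_mul_log_le h.pos (h.lower x) (h.upper x)
    have hqc : ∀ i, Continuous fun x => D i x ^ 2 / g x := fun i =>
      ((h.continuous_partial i).pow 2).div hcg fun x => (hpos x).ne'
    have hqb : ∀ i x, |D i x ^ 2 / g x| ≤ M ^ 2 / ε := fun i x =>
      abs_sq_div_le h.pos (h.lower x) (h.bound i x)
    have hsc : Continuous fun x => ∑ i : Fin n, D i.succ x ^ 2 / g x :=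
      continuous_finsetSum _ fun i _ => hqc _
    have hsb : ∀ x, |∑ i : Fin n, D i.succ x ^ 2 / g x| ≤ n * (M ^ 2 / ε) := fun x => by
      refine (Finset.abs_sum_le_sum_abs _ _).trans ?_
      refine (Finset.sum_le_sum fun i _ => hqb i.succ x).trans ?_
      simp
    set γ := ProbabilityTheory.gaussianReal 0 1 with hγ
    set F : ℝ → ℝ := fun t => ∫ y, g (Fin.cons t y) ∂(gaussianPi n) with hF
    set F' : ℝ → ℝ := fun t => ∫ y, D 0 (Fin.cons t y) ∂(gaussianPi n) with hF'
    set A : ℝ → ℝ := fun t =>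
      ∫ y, g (Fin.cons t y) * Real.log (g (Fin.cons t y)) ∂(gaussianPi n) with hA
    set S : ℝ → ℝ := fun t =>
      ∫ y, ∑ i : Fin n, D i.succ (Fin.cons t y) ^ 2 / g (Fin.cons t y) ∂(gaussianPi n) with hS
    set B : ℝ → ℝ := fun t =>
      ∫ y, D 0 (Fin.cons t y) ^ 2 / g (Fin.cons t y) ∂(gaussianPi n) with hB
    have iA : Integrable A γ := integrable_of_continuous_bdd
      (continuous_integral_finCons hec heb) fun t => abs_integral_le_of_bdd fun y => heb _
    have iS : Integrable S γ := integrable_of_continuous_bdd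
      (continuous_integral_finCons hsc hsb) fun t => abs_integral_le_of_bdd fun y => hsb _
    have iB : Integrable B γ := integrable_of_continuous_bdd
      (continuous_integral_finCons (hqc 0) (hqb 0)) fun t => abs_integral_le_of_bdd fun y => hqb 0 _
    have Fc : Continuous F := continuous_integral_finCons hcg hgb
    have islice : ∀ {f : (Fin (n + 1) → ℝ) → ℝ}, Continuous f → ∀ {C : ℝ}, (∀ x, |f x| ≤ C) →
        ∀ t, Integrable (fun y => f (Fin.cons t y)) (gaussianPi n) := fun hf C hC t =>
      integrable_of_continuous_bdd (hf.comp (continuous_finCons_right t)) fun y => hC _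
    have Fl : ∀ t, ε ≤ F t := fun t => by
      calc ε = ∫ y, ε ∂(gaussianPi n) := by simp
        _ ≤ F t := integral_mono (integrable_const _) (islice hcg hgb t) fun y => h.lower _
    have Fu : ∀ t, F t ≤ M := fun t =>
      (le_abs_self _).trans (abs_integral_le_of_bdd fun y => hgb _)
    have Fpos : ∀ t, 0 < F t := fun t => h.pos.trans_le (Fl t)
    have F'c : Continuous F' := continuous_integral_finCons (h.continuous_partial 0) (h.bound 0)
    have F'b : ∀ t, |F' t| ≤ M := fun t => abs_integral_le_of_bdd fun y => h.bound 0 _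
    have iFF : Integrable (fun t => F t * Real.log (F t)) γ := integrable_of_continuous_bdd
      (Fc.mul (Fc.log fun t => (Fpos t).ne')) fun t => abs_mul_log_le h.pos (Fl t) (Fu t)
    have iF' : Integrable (fun t => F' t ^ 2 / F t) γ := integrable_of_continuous_bdd
      ((F'c.pow 2).div Fc fun t => (Fpos t).ne') fun t => abs_sq_div_le h.pos (Fl t) (F'b t)
    have one := gaussian_logSobolev (fun t => h.hasDerivAt_marginal t) F'c h.pos Fl Fu F'b
    have slices : ∀ t, A t - F t * Real.log (F t) ≤ 1 / 2 * S t := fun t => ih (h.slice t)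
    have cs : ∀ t, F' t ^ 2 / F t ≤ B t := fun t =>
      sq_integral_div_le (islice hcg hgb t) (islice (h.continuous_partial 0) (h.bound 0) t)
        (islice (hqc 0) (hqb 0) t) (fun y => hpos _) (Fpos t)
    have I1 : ∫ t, A t ∂γ - ∫ t, F t * Real.log (F t) ∂γ ≤ 1 / 2 * ∫ t, S t ∂γ := by
      rw [← integral_sub iA iFF, ← integral_const_mul]
      exact integral_mono (iA.sub iFF) (iS.const_mul _) slices
    have I2 : ∫ t, F' t ^ 2 / F t ∂γ ≤ ∫ t, B t ∂γ := integral_mono iF' iB cs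
    rw [integral_gaussianPi_succ hec heb, integral_gaussianPi_succ hcg hgb]
    have e3 : ∫ x, ∑ i, D i x ^ 2 / g x ∂(gaussianPi (n + 1)) =
        ∫ t, B t ∂γ + ∫ t, S t ∂γ := by
      have : (fun x => ∑ i, D i x ^ 2 / g x) =
          fun x => D 0 x ^ 2 / g x + ∑ i : Fin n, D i.succ x ^ 2 / g x := by
        ext x; rw [Fin.sum_univ_succ]
      rw [this, integral_add (integrable_of_continuous_bdd (hqc 0) (hqb 0))
        (integrable_of_continuous_bdd hsc hsb), integral_gaussianPi_succ (hqc 0) (hqb 0),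
        integral_gaussianPi_succ hsc hsb]
    rw [e3]
    linarith

theorem gaussianPi_eq_withDensity (n : ℕ) :
    gaussianPi n = volume.withDensity fun x : Fin n → ℝ =>
      ENNReal.ofReal (∏ i, ProbabilityTheory.gaussianPDFReal 0 1 (x i)) := by
  refine Measure.pi_eq fun s hs => ?_
  have hp0 : ∀ x, 0 ≤ ProbabilityTheory.gaussianPDFReal 0 1 x := fun x =>
    ProbabilityTheory.gaussianPDFReal_nonneg 0 1 x
  have hi : ∀ i, Integrable ((s i).indicator (ProbabilityTheory.gaussianPDFReal 0 1)) := fun i =>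
    (ProbabilityTheory.integrable_gaussianPDFReal 0 1).indicator (hs i)
  have h0 : ∀ i x, 0 ≤ (s i).indicator (ProbabilityTheory.gaussianPDFReal 0 1) x := fun i x =>
    Set.indicator_nonneg (fun _ _ => hp0 _) x
  rw [withDensity_apply _ (MeasurableSet.univ_pi hs),
    ← lintegral_indicator (MeasurableSet.univ_pi hs)]
  have e1 : ∀ x : Fin n → ℝ, (Set.univ.pi s).indicator (fun x : Fin n → ℝ =>
      ENNReal.ofReal (∏ i, ProbabilityTheory.gaussianPDFReal 0 1 (x i))) x =
      ENNReal.ofReal (∏ i, (s i).indicator (ProbabilityTheory.gaussianPDFReal 0 1) (x i)) := by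
    intro x
    by_cases hx : x ∈ Set.univ.pi s
    · rw [Set.indicator_of_mem hx]
      congr 1
      refine Finset.prod_congr rfl fun i _ => ?_
      rw [Set.indicator_of_mem (hx i (Set.mem_univ i))]
    · rw [Set.indicator_of_notMem hx]
      simp only [Set.mem_pi, Set.mem_univ, true_implies, not_forall] at hx
      obtain ⟨i, hi⟩ := hx
      rw [Finset.prod_eq_zero (Finset.mem_univ i) (Set.indicator_of_notMem hi _),
        ENNReal.ofReal_zero]
  simp only [e1]
  rw [← ofReal_integral_eq_lintegral_ofReal
    (volume_pi (ι := Fin n) (α := fun _ => ℝ) ▸ Integrable.fintype_prod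
      (f := fun i => (s i).indicator (ProbabilityTheory.gaussianPDFReal 0 1)) hi)
    (Eventually.of_forall fun x => Finset.prod_nonneg fun i _ => h0 i _),
    integral_fintype_prod_volume_eq_prod
      (fun i => (s i).indicator (ProbabilityTheory.gaussianPDFReal 0 1)),
    ENNReal.ofReal_prod_of_nonneg fun i _ => integral_nonneg fun x => h0 i x]
  refine Finset.prod_congr rfl fun i _ => ?_
  rw [integral_indicator (hs i),
    ProbabilityTheory.gaussianReal_apply_eq_integral 0 one_ne_zero]

theorem integral_gaussianPi_eq {n : ℕ} (f : (Fin n → ℝ) → ℝ) :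
    ∫ x, f x ∂(gaussianPi n) =
      ∫ x, (∏ i, ProbabilityTheory.gaussianPDFReal 0 1 (x i)) * f x := by
  have hm : Measurable fun x : Fin n → ℝ =>
      ∏ i, ProbabilityTheory.gaussianPDFReal 0 1 (x i) := by fun_prop
  rw [gaussianPi_eq_withDensity, integral_withDensity_eq_integral_toReal_smul
    hm.ennreal_ofReal (Eventually.of_forall fun x => ENNReal.ofReal_lt_top)]
  refine integral_congr_ae (Eventually.of_forall fun x => ?_)
  simp only [smul_eq_mul]
  rw [ENNReal.toReal_ofReal (Finset.prod_nonneg fun i _ =>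
    ProbabilityTheory.gaussianPDFReal_nonneg 0 1 _)]

/-! ### The Euclidean logarithmic Sobolev inequality for test functions -/

theorem integral_add_three {X : Type*} [MeasurableSpace X] {μ : Measure X} {f g h : X → ℝ}
    (hf : Integrable f μ) (hg : Integrable g μ) (hh : Integrable h μ) :
    ∫ x, (f x + g x + h x) ∂μ = ∫ x, f x ∂μ + ∫ x, g x ∂μ + ∫ x, h x ∂μ := by
  rw [integral_add (f := fun x => f x + g x) (hf.add hg) hh, integral_add hf hg]

theorem prod_gaussianPDFReal_pos {n : ℕ} (x : Fin n → ℝ) :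
    0 < ∏ i, ProbabilityTheory.gaussianPDFReal 0 1 (x i) :=
  Finset.prod_pos fun _ _ => ProbabilityTheory.gaussianPDFReal_pos 0 1 _ one_ne_zero

theorem log_prod_gaussianPDFReal {n : ℕ} (x : Fin n → ℝ) :
    Real.log (∏ i, ProbabilityTheory.gaussianPDFReal 0 1 (x i)) =
      -(n / 2 * Real.log (2 * Real.pi)) - (∑ i, x i ^ 2) / 2 := by
  rw [Real.log_prod fun i _ =>
    (ProbabilityTheory.gaussianPDFReal_pos 0 1 (x i) one_ne_zero).ne']
  simp only [log_gaussianPDFReal_zero_one, Finset.sum_sub_distrib, Finset.sum_const,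
    Finset.card_univ, Fintype.card_fin, nsmul_eq_mul, Finset.sum_div]
  ring

theorem hasDerivAt_prod_gaussianPDFReal {n : ℕ} (i : Fin n) (x : Fin n → ℝ) :
    HasDerivAt (fun t => ∏ j, ProbabilityTheory.gaussianPDFReal 0 1 (Function.update x i t j))
      (-x i * ∏ j, ProbabilityTheory.gaussianPDFReal 0 1 (x j)) (x i) := by
  have h1 : ∀ t, ∏ j, ProbabilityTheory.gaussianPDFReal 0 1 (Function.update x i t j) =
      ProbabilityTheory.gaussianPDFReal 0 1 t *
        ∏ j ∈ Finset.univ.erase i, ProbabilityTheory.gaussianPDFReal 0 1 (x j) := fun t => by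
    rw [← Finset.mul_prod_erase _ _ (Finset.mem_univ i), Function.update_self]
    congr 1
    refine Finset.prod_congr rfl fun j hj => ?_
    rw [Function.update_of_ne (Finset.ne_of_mem_erase hj)]
  simp only [h1]
  rw [← Finset.mul_prod_erase _ _ (Finset.mem_univ i), ← mul_assoc]
  exact (hasDerivAt_gaussianPDFReal_zero_one _).mul_const _

theorem continuous_prod_gaussianPDFReal {n : ℕ} :
    Continuous fun x : Fin n → ℝ => ∏ i, ProbabilityTheory.gaussianPDFReal 0 1 (x i) :=
  continuous_finsetProd _ fun i _ => continuous_gaussianPDFReal_zero_one.comp (continuous_apply i)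

theorem hasDerivAt_comp_update {n : ℕ} {f : (Fin n → ℝ) → ℝ} (hf : Differentiable ℝ f) (i : Fin n)
    (x : Fin n → ℝ) :
    HasDerivAt (fun t => f (Function.update x i t)) (fderiv ℝ f x (Pi.single i 1)) (x i) := by
  have h1 : HasFDerivAt f (fderiv ℝ f x) (Function.update x i (x i)) := by
    rw [Function.update_eq_self]; exact (hf x).hasFDerivAt
  exact h1.comp_hasDerivAt (x i) (hasDerivAt_update x i (x i))

theorem abs_mul_log_le_of_le {t M : ℝ} (h0 : 0 ≤ t) (h1 : t ≤ M) :
    |t * Real.log t| ≤ M * |Real.log M| + 1 := by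
  have hM : 0 ≤ M * |Real.log M| := mul_nonneg (h0.trans h1) (abs_nonneg _)
  rcases h0.eq_or_lt with rfl | ht
  · simpa using by linarith
  rw [abs_le]
  constructor
  · have := Real.one_sub_inv_le_log_of_pos ht
    have h2 := mul_le_mul_of_nonneg_left this ht.le
    rw [mul_sub, mul_inv_cancel₀ ht.ne'] at h2
    linarith
  · have h3 : Real.log t ≤ |Real.log M| := (Real.log_le_log ht h1).trans (le_abs_self _)
    have h4 := mul_le_mul h1 h3
    by_cases hl : 0 ≤ Real.log t
    · linarith [h4 hl (ht.le.trans h1)]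
    · have : t * Real.log t ≤ 0 := mul_nonpos_of_nonneg_of_nonpos ht.le (not_le.1 hl).le
      linarith

theorem HasCompactSupport.of_imp {X Y Z : Type*} [TopologicalSpace X] [Zero Y] [Zero Z]
    {f : X → Y} {g : X → Z} (hf : HasCompactSupport f) (h : ∀ x, f x = 0 → g x = 0) :
    HasCompactSupport g :=
  hf.mono fun x hx h0 => hx (h x h0)

/-- Integration by parts of `x i` against `∂ᵢ (f²) = 2 f ∂ᵢ f`. -/
theorem integral_mul_fderiv_coord {n : ℕ} {f : (Fin n → ℝ) → ℝ} (hf : ContDiff ℝ 1 f)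
    (hs : HasCompactSupport f) (i : Fin n) :
    ∫ x, f x * fderiv ℝ f x (Pi.single i 1) * x i = -(1 / 2) * ∫ x, f x ^ 2 := by
  have hd : Differentiable ℝ f := hf.differentiable one_ne_zero
  have hfc : Continuous f := hf.continuous
  have hDc : Continuous fun x => fderiv ℝ f x (Pi.single i 1) :=
    (hf.continuous_fderiv one_ne_zero).clm_apply continuous_const
  have h2 : ∀ x, fderiv ℝ (fun x => f x ^ 2) x (Pi.single i 1) =
      2 * (f x * fderiv ℝ f x (Pi.single i 1)) := fun x => by
    have := ((hd x).hasFDerivAt.pow 2).fderiv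
    simp only [Nat.add_one_sub_one, pow_one] at this
    rw [this]; simp; ring
  have h1 : ∀ x : Fin n → ℝ, fderiv ℝ (fun x : Fin n → ℝ => x i) x (Pi.single i 1) = 1 :=
    fun x => by
    have : fderiv ℝ (fun x : Fin n → ℝ => x i) x = ContinuousLinearMap.proj i :=
      (ContinuousLinearMap.proj (R := ℝ) (φ := fun _ : Fin n => ℝ) i).hasFDerivAt.fderiv
    rw [this]; simp
  have key := integral_mul_fderiv_eq_neg_fderiv_mul_of_integrable
    (μ := (volume : Measure (Fin n → ℝ)))
    (f := fun x : Fin n → ℝ => x i) (g := fun x => f x ^ 2) (v := Pi.single i 1) ?_ ?_ ?_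
    (fun x _ => by fun_prop) (fun x _ => (hd x).pow 2)
  · simp only [h1, h2, one_mul] at key
    rw [← integral_const_mul] at *
    have e : ∀ x : Fin n → ℝ, x i * (2 * (f x * fderiv ℝ f x (Pi.single i 1))) =
        2 * (f x * fderiv ℝ f x (Pi.single i 1) * x i) := fun x => by ring
    simp only [e] at key
    rw [integral_const_mul] at key ⊢
    linarith
  · simp only [h1, one_mul]
    exact (hfc.pow 2).integrable_of_hasCompactSupport (hs.of_imp fun x hx => by simp [hx])
  · simp only [h2]
    exact Continuous.integrable_of_hasCompactSupport (by fun_prop)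
      (hs.of_imp fun x hx => by simp [hx])
  · exact Continuous.integrable_of_hasCompactSupport (by fun_prop)
      (hs.of_imp fun x hx => by simp [hx])

/-- The Euclidean logarithmic Sobolev inequality in coordinates. It is the Gaussian inequality for
`f² / P + ε`, where `P` is the Gaussian density, in the limit `ε → 0`. -/
theorem logSobolev_pi {n : ℕ} {f : (Fin n → ℝ) → ℝ} (hf : ContDiff ℝ 1 f)
    (hs : HasCompactSupport f) :
    ∫ x, f x ^ 2 * Real.log (f x ^ 2) ≤ (∫ x, f x ^ 2) * Real.log (∫ x, f x ^ 2) -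
      (n / 2 * Real.log (2 * Real.pi) + n) * (∫ x, f x ^ 2) +
      2 * ∫ x, ∑ i, fderiv ℝ f x (Pi.single i 1) ^ 2 := by
  have hd : Differentiable ℝ f := hf.differentiable one_ne_zero
  have hfc : Continuous f := hf.continuous
  set F : Fin n → (Fin n → ℝ) → ℝ := fun i x => fderiv ℝ f x (Pi.single i 1) with hF
  have hFc : ∀ i, Continuous (F i) := fun i =>
    (hf.continuous_fderiv one_ne_zero).clm_apply continuous_const
  have hFs : ∀ i, HasCompactSupport (F i) := fun i => hs.fderiv_apply ℝ _
  set P : (Fin n → ℝ) → ℝ := fun x => ∏ i, ProbabilityTheory.gaussianPDFReal 0 1 (x i) with hP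
  have hPc : Continuous P := continuous_prod_gaussianPDFReal
  have hPpos : ∀ x, 0 < P x := prod_gaussianPDFReal_pos
  have hlogP : ∀ x, Real.log (P x) =
    -(n / 2 * Real.log (2 * Real.pi)) - (∑ i, x i ^ 2) / 2 := log_prod_gaussianPDFReal
  have hs2 : HasCompactSupport fun x => f x ^ 2 := hs.of_imp fun x hx => by simp [hx]
  set h : (Fin n → ℝ) → ℝ := fun x => f x ^ 2 / P x with hh
  have hhc : Continuous h := (hfc.pow 2).div hPc fun x => (hPpos x).ne'
  have hhs : HasCompactSupport h := hs.of_imp fun x hx => by simp [hh, hx]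
  have hh0 : ∀ x, 0 ≤ h x := fun x => div_nonneg (sq_nonneg _) (hPpos x).le
  have hhP : ∀ x, h x * P x = f x ^ 2 := fun x => div_mul_cancel₀ _ (hPpos x).ne'
  set D : Fin n → (Fin n → ℝ) → ℝ := fun i x => f x * (2 * F i x + f x * x i) / P x with hD
  have hDc : ∀ i, Continuous (D i) := fun i => by
    have := hFc i
    exact Continuous.div (by fun_prop) hPc fun x => (hPpos x).ne'
  have hDs : ∀ i, HasCompactSupport (D i) := fun i => hs.of_imp fun x hx => by simp [hD, hx]
  obtain ⟨C0, hC0⟩ := hhs.exists_bound_of_continuous hhc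
  have hCi : ∃ C, ∀ i x, |D i x| ≤ C := by
    choose C hC using fun i => (hDs i).exists_bound_of_continuous (hDc i)
    exact ⟨∑ i, |C i|, fun i x => (hC i x).trans ((le_abs_self _).trans
      (Finset.single_le_sum (f := fun i => |C i|) (fun _ _ => abs_nonneg _) (Finset.mem_univ i)))⟩
  obtain ⟨C1, hC1⟩ := hCi
  have hC00 : 0 ≤ C0 := (norm_nonneg _).trans (hC0 0)
  have hbp : ∀ ε : ℝ, 0 < ε → HasBoundedPartials (fun x => h x + ε) D ε (C0 + |C1| + ε) := by
    intro ε hε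
    refine ⟨hε, fun i x => ?_, hhc.add continuous_const, hDc, fun x => ?_, fun x => ?_,
      fun i x => ?_⟩
    · have h1 := ((hasDerivAt_comp_update hd i x).pow 2).div
        (hasDerivAt_prod_gaussianPDFReal i x) (by
          rw [Function.update_eq_self]; exact (hPpos x).ne')
      refine (h1.add_const ε).congr_deriv ?_
      have := (hPpos x).ne'
      simp only [Pi.pow_apply, Function.update_eq_self, hD, hF, hP] at this ⊢
      field_simp
      push_cast
      ring
    · linarith [hh0 x]
    · have := (le_abs_self _).trans (hC0 x)
      linarith [abs_nonneg C1]
    · have := (hC1 i x).trans (le_abs_self _)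
      linarith
  set m := ∫ x, f x ^ 2 with hm
  have hf2i : Integrable fun x => f x ^ 2 :=
    (hfc.pow 2).integrable_of_hasCompactSupport hs2
  have hm0 : 0 ≤ m := integral_nonneg fun x => sq_nonneg _
  have hPi : Integrable P := by
    have := Integrable.fintype_prod (ι := Fin n) (μ := fun _ => (volume : Measure ℝ))
      (f := fun _ => ProbabilityTheory.gaussianPDFReal 0 1)
      (fun _ => by exact ProbabilityTheory.integrable_gaussianPDFReal 0 1)
    rwa [← volume_pi] at this
  have hP1 : ∫ x, P x = 1 := by
    have := integral_gaussianPi_eq (n := n) fun _ => 1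
    simpa using this.symm
  -- integrands of the right-hand side, after expanding the square
  have hcs : ∀ i, Integrable fun x => (2 * F i x + f x * x i) ^ 2 := fun i => by
    have := hFc i
    have e : HasCompactSupport fun x => 2 * F i x + f x * x i :=
      ((hFs i).of_imp fun x hx => by simp [hx] : HasCompactSupport fun x => 2 * F i x).add
        (hs.of_imp fun x hx => by simp [hx])
    exact Continuous.integrable_of_hasCompactSupport (by fun_prop)
      (e.of_imp fun x hx => by simp [hx])
  have iF2 : ∀ i, Integrable fun x => F i x ^ 2 := fun i =>
    ((hFc i).pow 2).integrable_of_hasCompactSupport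
      ((hFs i).of_imp fun x hx => by simp [hx])
  have ifF : ∀ i, Integrable fun x => f x * F i x * x i := fun i => by
    have := hFc i
    exact Continuous.integrable_of_hasCompactSupport (by fun_prop)
      (hs.of_imp fun x hx => by simp [hx])
  have ifx : ∀ i, Integrable fun x : Fin n → ℝ => f x ^ 2 * x i ^ 2 := fun i =>
    Continuous.integrable_of_hasCompactSupport (by fun_prop)
      (hs.of_imp fun x hx => by simp [hx])
  have hexp : ∀ i, ∫ x, (2 * F i x + f x * x i) ^ 2 =
      4 * (∫ x, F i x ^ 2) - 2 * m + ∫ x, f x ^ 2 * x i ^ 2 := fun i => by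
    have e : (fun x => (2 * F i x + f x * x i) ^ 2) = fun x =>
        (4 * F i x ^ 2 + 4 * (f x * F i x * x i)) + f x ^ 2 * x i ^ 2 := by ext x; ring
    have j := integral_mul_fderiv_coord hf hs i
    rw [e, integral_add_three ((iF2 i).const_mul 4) ((ifF i).const_mul 4) (ifx i),
      integral_const_mul,
      integral_const_mul, j]
    ring
  set X := ∫ x : Fin n → ℝ, f x ^ 2 * ∑ i, x i ^ 2 with hX
  have hrhs : ∀ ε : ℝ, 0 < ε →
      ∫ x, ∑ i, D i x ^ 2 / (h x + ε) ∂(gaussianPi n) ≤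
        4 * (∫ x, ∑ i, F i x ^ 2) - 2 * n * m + X := by
    intro ε hε
    rw [integral_gaussianPi_eq]
    have hpt : ∀ x, P x * ∑ i, D i x ^ 2 / (h x + ε) ≤ ∑ i, (2 * F i x + f x * x i) ^ 2 := by
      intro x
      rw [Finset.mul_sum]
      refine Finset.sum_le_sum fun i _ => ?_
      have h1 := hPpos x
      have h2 := hh0 x
      have e : P x * (D i x ^ 2 / (h x + ε)) =
          (2 * F i x + f x * x i) ^ 2 * (h x / (h x + ε)) := by
        have : f x ^ 2 = h x * P x := (hhP x).symm
        have e2 : D i x ^ 2 = h x * (2 * F i x + f x * x i) ^ 2 / P x := by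
          simp only [hD, div_pow, mul_pow]
          rw [this]; field_simp
        rw [e2]; field_simp
      rw [e]
      exact mul_le_of_le_one_right (sq_nonneg _) ((div_le_one (by positivity)).2 (by linarith))
    have hle : ∫ x, P x * ∑ i, D i x ^ 2 / (h x + ε) ≤
        ∫ x, ∑ i, (2 * F i x + f x * x i) ^ 2 := by
      refine integral_mono_of_nonneg (Eventually.of_forall fun x => ?_)
        (integrable_finsetSum _ fun i _ => hcs i) (Eventually.of_forall hpt)
      exact mul_nonneg (hPpos x).le (Finset.sum_nonneg fun i _ =>
        div_nonneg (sq_nonneg _) (by linarith [hh0 x]))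
    refine hle.trans_eq ?_
    rw [integral_finsetSum _ fun i _ => hcs i, integral_finsetSum _ fun i _ => iF2 i]
    simp only [hexp, Finset.sum_add_distrib, Finset.sum_sub_distrib, ← Finset.mul_sum,
      Finset.sum_const, Finset.card_univ, Fintype.card_fin, nsmul_eq_mul]
    rw [← integral_finsetSum _ fun i _ => ifx i]
    simp only [hX, Finset.mul_sum]
    ring
  have hineq : ∀ ε : ℝ, 0 < ε →
      (∫ x, P x * ((h x + ε) * Real.log (h x + ε))) - (m + ε) * Real.log (m + ε) ≤
        2 * (∫ x, ∑ i, F i x ^ 2) - n * m + X / 2 := by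
    intro ε hε
    have h1 := gaussianPi_logSobolev (hbp ε hε)
    have h2 := hrhs ε hε
    have h3 : ∫ x, (h x + ε) ∂(gaussianPi n) = m + ε := by
      rw [integral_gaussianPi_eq]
      have e : ∀ x, P x * (h x + ε) = f x ^ 2 + ε * P x := fun x => by rw [← hhP x]; ring
      rw [integral_congr_ae (Eventually.of_forall e), integral_add hf2i (hPi.const_mul ε),
        integral_const_mul, hP1, mul_one]
    rw [h3, integral_gaussianPi_eq] at h1
    linarith
  have hlim1 : Tendsto (fun ε : ℝ => ∫ x, P x * ((h x + ε) * Real.log (h x + ε))) (𝓝[>] 0)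
      (𝓝 (∫ x, P x * (h x * Real.log (h x)))) := by
    refine tendsto_integral_filter_of_dominated_convergence
      (fun x => P x * ((C0 + 1) * |Real.log (C0 + 1)| + 1)) (Eventually.of_forall fun ε => ?_) ?_
      (hPi.mul_const _) (Eventually.of_forall fun x => ?_)
    · exact (hPc.mul (Real.continuous_mul_log.comp
        (hhc.add continuous_const))).aestronglyMeasurable
    · filter_upwards [Ioo_mem_nhdsGT (zero_lt_one' ℝ)] with ε hε
      refine Eventually.of_forall fun x => ?_
      rw [norm_mul, Real.norm_of_nonneg (hPpos x).le]
      refine mul_le_mul_of_nonneg_left (abs_mul_log_le_of_le ?_ ?_) (hPpos x).le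
      · linarith [hh0 x, hε.1]
      · linarith [(le_abs_self _).trans (hC0 x), hε.2]
    · have : Continuous fun ε : ℝ => P x * ((h x + ε) * Real.log (h x + ε)) :=
        continuous_const.mul (Real.continuous_mul_log.comp (continuous_const.add continuous_id))
      have h := (this.tendsto 0).mono_left (nhdsWithin_le_nhds (s := Set.Ioi 0))
      rwa [add_zero] at h
  have hlim2 : Tendsto (fun ε : ℝ => (m + ε) * Real.log (m + ε)) (𝓝[>] 0)
      (𝓝 (m * Real.log m)) := by
    have : Continuous fun ε : ℝ => (m + ε) * Real.log (m + ε) :=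
      Real.continuous_mul_log.comp (continuous_const.add continuous_id)
    have h := (this.tendsto 0).mono_left (nhdsWithin_le_nhds (s := Set.Ioi 0))
    rwa [add_zero] at h
  have hfin := le_of_tendsto (hlim1.sub hlim2)
    (eventually_nhdsWithin_of_forall fun ε hε => hineq ε hε)
  have hent : ∫ x, P x * (h x * Real.log (h x)) =
      (∫ x, f x ^ 2 * Real.log (f x ^ 2)) + n / 2 * Real.log (2 * Real.pi) * m + X / 2 := by
    have e : ∀ x, P x * (h x * Real.log (h x)) = (f x ^ 2 * Real.log (f x ^ 2) +
        n / 2 * Real.log (2 * Real.pi) * f x ^ 2) + 1 / 2 * (f x ^ 2 * ∑ i, x i ^ 2) := fun x => by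
      rcases eq_or_ne (f x) 0 with h0 | h0
      · simp [hh, h0]
      · have e1 : Real.log (h x) = Real.log (f x ^ 2) - Real.log (P x) :=
          Real.log_div (pow_ne_zero 2 h0) (hPpos x).ne'
        rw [e1, hlogP, ← mul_assoc, mul_comm (P x), hhP]
        ring
    have i1 : Integrable fun x => f x ^ 2 * Real.log (f x ^ 2) :=
      (Real.continuous_mul_log.comp (hfc.pow 2)).integrable_of_hasCompactSupport
        (hs.of_imp fun x hx => by simp [hx])
    have i2 : Integrable fun x : Fin n → ℝ => f x ^ 2 * ∑ i, x i ^ 2 :=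
      Continuous.integrable_of_hasCompactSupport (by fun_prop) (hs.of_imp fun x hx => by simp [hx])
    rw [integral_congr_ae (Eventually.of_forall e),
      integral_add_three i1 (hf2i.const_mul _) (i2.const_mul _), integral_const_mul,
      integral_const_mul]
    ring
  rw [hent] at hfin
  linarith

theorem gradient_apply_eq_fderiv_single {n : ℕ} (φ : EuclideanSpace ℝ (Fin n) → ℝ)
    (y : EuclideanSpace ℝ (Fin n)) (i : Fin n) :
    gradient φ y i = fderiv ℝ φ y (EuclideanSpace.single i 1) := by
  rw [← inner_gradient_left, EuclideanSpace.inner_single_right]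
  simp

/-- The Euclidean logarithmic Sobolev inequality for test functions, in the form that is not
invariant under scaling. -/
theorem logSobolev_test {n : ℕ} {φ : EuclideanSpace ℝ (Fin n) → ℝ} (hφ : ContDiff ℝ 1 φ)
    (hs : HasCompactSupport φ) :
    ∫ x, φ x ^ 2 * Real.log (φ x ^ 2) ≤ (∫ x, φ x ^ 2) * Real.log (∫ x, φ x ^ 2) -
      (n / 2 * Real.log (2 * Real.pi) + n) * (∫ x, φ x ^ 2) + 2 * ∫ x, ‖gradient φ x‖ ^ 2 := by
  set e := (EuclideanSpace.equiv (Fin n) ℝ).symm with he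
  have hmp : ∀ f : EuclideanSpace ℝ (Fin n) → ℝ, ∫ x, f (e x) = ∫ x, f x := fun f =>
    (PiLp.volume_preserving_toLp (Fin n)).integral_comp
      (MeasurableEquiv.toLp 2 (Fin n → ℝ)).measurableEmbedding f
  have h1 := logSobolev_pi (f := fun x => φ (e x)) (hφ.comp e.contDiff)
    (hs.comp_homeomorph e.toHomeomorph)
  have h2 : ∀ x, ∑ i, fderiv ℝ (fun x => φ (e x)) x (Pi.single i 1) ^ 2 =
      ‖gradient φ (e x)‖ ^ 2 := fun x => by
    rw [EuclideanSpace.norm_sq_eq]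
    refine Finset.sum_congr rfl fun i _ => ?_
    have h3 : fderiv ℝ (fun x => φ (e x)) x = (fderiv ℝ φ (e x)).comp (e : _ →L[ℝ] _) :=
      ((hφ.differentiable one_ne_zero (e x)).hasFDerivAt.comp x e.hasFDerivAt).fderiv
    rw [h3, gradient_apply_eq_fderiv_single, Real.norm_eq_abs, sq_abs]
    rfl
  simp only [h2] at h1
  rw [hmp fun x => φ x ^ 2 * Real.log (φ x ^ 2), hmp fun x => φ x ^ 2,
    hmp fun x => ‖gradient φ x‖ ^ 2] at h1
  exact h1

theorem gradient_comp_smul {E : Type*} [NormedAddCommGroup E] [InnerProductSpace ℝ E]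
    [CompleteSpace E] {φ : E → ℝ} (hφ : Differentiable ℝ φ) (r : ℝ) (x : E) :
    gradient (fun y => φ (r • y)) x = r • gradient φ (r • x) := by
  refine HasGradientAt.gradient (hasGradientAt_iff_hasFDerivAt.2 ?_)
  have h1 : HasFDerivAt (fun y : E => r • y) (r • ContinuousLinearMap.id ℝ E) x :=
    (hasFDerivAt_id x).const_smul r
  have h2 := (hφ (r • x)).hasGradientAt.hasFDerivAt.comp x h1
  refine h2.congr_fderiv ?_
  ext v
  simp

/-- The scaled form of the logarithmic Sobolev inequality for test functions; its right-hand side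
is to be optimized over `r`. -/
theorem logSobolev_test_scaled {n : ℕ} {φ : EuclideanSpace ℝ (Fin n) → ℝ} (hφ : ContDiff ℝ 1 φ)
    (hs : HasCompactSupport φ) {r : ℝ} (hr : 0 < r) :
    ∫ x, φ x ^ 2 * Real.log (φ x ^ 2) ≤ (∫ x, φ x ^ 2) * Real.log (∫ x, φ x ^ 2) -
      (n * Real.log r + n / 2 * Real.log (2 * Real.pi) + n) * (∫ x, φ x ^ 2) +
      2 * r ^ 2 * ∫ x, ‖gradient φ x‖ ^ 2 := by
  have hc : Continuous fun x : EuclideanSpace ℝ (Fin n) => r • x := continuous_const_smul r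
  have h1 := logSobolev_test (φ := fun x => φ (r • x))
    (hφ.comp (contDiff_const_smul r)) (hs.comp_smul hr.ne')
  have hsc : ∀ f : EuclideanSpace ℝ (Fin n) → ℝ,
      ∫ x, f (r • x) = (r ^ n)⁻¹ * ∫ x, f x := fun f => by
    rw [Measure.integral_comp_smul_of_nonneg _ _ _ (hR := hr.le)]
    simp
  simp only [gradient_comp_smul (hφ.differentiable one_ne_zero), norm_smul, mul_pow] at h1
  rw [integral_const_mul, hsc fun x => φ x ^ 2 * Real.log (φ x ^ 2), hsc fun x => φ x ^ 2,
    hsc fun x => ‖gradient φ x‖ ^ 2, Real.norm_of_nonneg hr.le] at h1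
  set m := ∫ x, φ x ^ 2 with hm
  have hm0 : 0 ≤ m := integral_nonneg fun x => sq_nonneg _
  have hrn : 0 < (r ^ n)⁻¹ := by positivity
  have h2 : (r ^ n)⁻¹ * m * Real.log ((r ^ n)⁻¹ * m) =
      (r ^ n)⁻¹ * (m * Real.log m - n * Real.log r * m) := by
    rcases hm0.eq_or_lt with h0 | h0
    · rw [← h0]; simp
    · rw [Real.log_mul hrn.ne' h0.ne', Real.log_inv, Real.log_pow]; ring
  rw [h2] at h1
  refine le_of_mul_le_mul_left ?_ hrn
  linarith

/-! ### Cutoff sequences -/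

section Cutoff

variable {E : Type*} [NormedAddCommGroup E] [InnerProductSpace ℝ E]

theorem gradient_fun_mul [CompleteSpace E] {f g : E → ℝ} {x : E} (hf : DifferentiableAt ℝ f x)
    (hg : DifferentiableAt ℝ g x) :
    gradient (fun y => f y * g y) x = f x • gradient g x + g x • gradient f x := by
  refine HasGradientAt.gradient (hasGradientAt_iff_hasFDerivAt.2 ?_)
  refine (hf.hasFDerivAt.mul hg.hasFDerivAt).congr_fderiv ?_
  rw [map_add, map_smul, map_smul, toDual_gradient, toDual_gradient]

theorem continuous_gradient [CompleteSpace E] {f : E → ℝ} {k : WithTop ℕ∞} (hf : ContDiff ℝ k f)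
    (hk : k ≠ 0) : Continuous (gradient f) :=
  (InnerProductSpace.toDual ℝ E).symm.continuous.comp (hf.continuous_fderiv hk)

theorem HasCompactSupport.gradient [CompleteSpace E] {f : E → ℝ} (hf : HasCompactSupport f) :
    HasCompactSupport (gradient f) :=
  (hf.fderiv ℝ).of_imp fun x hx => by simp [_root_.gradient, hx]

theorem norm_smul_add_smul_sq_le {s t : ℝ} {v w : E} :
    ‖s • v + t • w‖ ^ 2 ≤ 2 * (s ^ 2 * ‖v‖ ^ 2) + 2 * (t ^ 2 * ‖w‖ ^ 2) := by
  have h := norm_add_le (s • v) (t • w)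
  rw [norm_smul, norm_smul] at h
  have h0 := norm_nonneg (s • v + t • w)
  have e1 : s ^ 2 * ‖v‖ ^ 2 = (‖s‖ * ‖v‖) ^ 2 := by rw [mul_pow, Real.norm_eq_abs, sq_abs]
  have e2 : t ^ 2 * ‖w‖ ^ 2 = (‖t‖ * ‖w‖) ^ 2 := by rw [mul_pow, Real.norm_eq_abs, sq_abs]
  rw [e1, e2]
  nlinarith [sq_nonneg (‖s‖ * ‖v‖ - ‖t‖ * ‖w‖)]

/-- Smooth cutoff functions with compact support in `Ω` that are eventually `1` at each point of
`Ω`, with gradients of size at most `ρ / (k + 1)`. -/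
structure IsCutoffSeq [CompleteSpace E] (Ω : Set E) (ρ : E → ℝ) (χ : ℕ → E → ℝ) : Prop where
  contDiff : ∀ k, ContDiff ℝ ∞ (χ k)
  hasCompactSupport : ∀ k, HasCompactSupport (χ k)
  tsupport_subset : ∀ k, tsupport (χ k) ⊆ Ω
  nonneg : ∀ k x, 0 ≤ χ k x
  le_one : ∀ k x, χ k x ≤ 1
  eventually_eq_one : ∀ x ∈ Ω, ∀ᶠ k in atTop, χ k x = 1
  norm_gradient_le : ∀ k x, ‖gradient (χ k) x‖ ≤ ρ x / (k + 1)

theorem IsCutoffSeq.tendsto_gradient [CompleteSpace E] {Ω : Set E} {ρ : E → ℝ} {χ : ℕ → E → ℝ}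
    (h : IsCutoffSeq Ω ρ χ) (x : E) : Tendsto (fun k => gradient (χ k) x) atTop (𝓝 0) := by
  refine squeeze_zero_norm (fun k => h.norm_gradient_le k x) ?_
  have := (tendsto_one_div_add_atTop_nhds_zero_nat (𝕜 := ℝ)).const_mul (ρ x)
  simpa [div_eq_mul_inv] using this

theorem IsCutoffSeq.norm_gradient_le' [CompleteSpace E] {Ω : Set E} {ρ : E → ℝ} {χ : ℕ → E → ℝ}
    (h : IsCutoffSeq Ω ρ χ) (k : ℕ) (x : E) : ‖gradient (χ k) x‖ ≤ ρ x := by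
  have h1 := h.norm_gradient_le k x
  have h2 : 0 ≤ ρ x := by
    have h3 := (norm_nonneg _).trans h1
    by_contra hneg
    exact absurd h3 (not_le.2 (div_neg_of_neg_of_pos (not_le.1 hneg) (by positivity)))
  refine h1.trans (div_le_self h2 ?_)
  linarith [(Nat.cast_nonneg k : (0 : ℝ) ≤ k)]

theorem exists_isCutoffSeq_univ [FiniteDimensional ℝ E] :
    ∃ (C : ℝ) (χ : ℕ → E → ℝ), IsCutoffSeq Set.univ (fun _ => C) χ := by
  let b : ContDiffBump (0 : E) := ⟨1, 2, one_pos, one_lt_two⟩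
  have hb : ContDiff ℝ ∞ b := b.contDiff
  have hbd : Differentiable ℝ b := hb.differentiable (by simp)
  obtain ⟨C, hC⟩ := b.hasCompactSupport.gradient.exists_bound_of_continuous
    (continuous_gradient hb (by simp))
  refine ⟨C, fun k x => b (((k : ℝ) + 1)⁻¹ • x), ?_⟩
  have hk : ∀ k : ℕ, (0 : ℝ) < (k : ℝ) + 1 := fun k => by positivity
  refine ⟨fun k => hb.comp (contDiff_const_smul _), fun k =>
    b.hasCompactSupport.comp_smul (inv_pos.2 (hk k)).ne', fun k => Set.subset_univ _,
    fun k x => b.nonneg, fun k x => b.le_one, fun x _ => ?_, fun k x => ?_⟩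
  · filter_upwards [eventually_ge_atTop ⌈‖x‖⌉₊] with k hk'
    refine b.one_of_mem_closedBall ?_
    rw [mem_closedBall_zero_iff, norm_smul, Real.norm_of_nonneg (inv_pos.2 (hk k)).le,
      inv_mul_le_iff₀ (hk k)]
    have : ‖x‖ ≤ k := Nat.ceil_le.1 hk'
    change ‖x‖ ≤ (k + 1) * 1
    linarith
  · rw [gradient_comp_smul hbd, norm_smul, Real.norm_of_nonneg (inv_pos.2 (hk k)).le,
      inv_mul_eq_div]
    exact div_le_div_of_nonneg_right (hC _) (hk k).le

end Cutoff

/-! ### The logarithmic Sobolev inequality in the Sobolev space -/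

section Ltwo

variable {X F : Type*} [MeasurableSpace X] {μ : Measure X} [NormedAddCommGroup F]

theorem lintegral_ofReal_norm_sq_eq (f : X → F) :
    ∫⁻ x, ENNReal.ofReal (‖f x‖ ^ 2) ∂μ = eLpNorm f 2 μ ^ 2 := by
  have h := eLpNorm_nnreal_pow_eq_lintegral (μ := μ) (f := f) (p := 2) (by norm_num)
  norm_num at h
  rw [h]
  refine lintegral_congr fun x => ?_
  rw [ENNReal.ofReal_pow (norm_nonneg _), ofReal_norm]

theorem integral_norm_sq_eq {f : X → F} (hf : AEStronglyMeasurable f μ) :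
    ∫ x, ‖f x‖ ^ 2 ∂μ = (eLpNorm f 2 μ).toReal ^ 2 := by
  rw [integral_eq_lintegral_of_nonneg_ae (Eventually.of_forall fun x => sq_nonneg _)
    (hf.norm.pow 2), lintegral_ofReal_norm_sq_eq, ENNReal.toReal_pow]

theorem tendsto_eLpNorm_two {fn : ℕ → X → F} {f : X → F}
    (h : Tendsto (fun n => ∫⁻ x, ENNReal.ofReal (‖fn n x - f x‖ ^ 2) ∂μ) atTop (𝓝 0)) :
    Tendsto (fun n => eLpNorm (fn n - f) 2 μ) atTop (𝓝 0) := by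
  have h1 : ∀ n, eLpNorm (fn n - f) 2 μ =
      (∫⁻ x, ENNReal.ofReal (‖fn n x - f x‖ ^ 2) ∂μ) ^ (1 / 2 : ℝ) := fun n => by
    have := lintegral_ofReal_norm_sq_eq (μ := μ) (fn n - f)
    simp only [Pi.sub_apply] at this
    rw [this, ← ENNReal.rpow_natCast, ← ENNReal.rpow_mul]
    norm_num
  simp only [h1]
  have := h.ennrpow_const (1 / 2)
  rwa [ENNReal.zero_rpow_of_pos (by norm_num)] at this

theorem memLp_two_of_tendsto {fn : ℕ → X → F} {f : X → F} (hfn : ∀ n, MemLp (fn n) 2 μ)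
    (hf : AEStronglyMeasurable f μ)
    (h : Tendsto (fun n => ∫⁻ x, ENNReal.ofReal (‖fn n x - f x‖ ^ 2) ∂μ) atTop (𝓝 0)) :
    MemLp f 2 μ := by
  obtain ⟨n, hn⟩ := ((tendsto_eLpNorm_two h).eventually (gt_mem_nhds one_pos)).exists
  have h1 : MemLp (fn n - f) 2 μ := ⟨(hfn n).1.sub hf, hn.trans ENNReal.one_lt_top⟩
  simpa using (hfn n).sub h1

theorem tendsto_integral_norm_sq {fn : ℕ → X → F} {f : X → F} (hfn : ∀ n, MemLp (fn n) 2 μ)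
    (hf : MemLp f 2 μ)
    (h : Tendsto (fun n => ∫⁻ x, ENNReal.ofReal (‖fn n x - f x‖ ^ 2) ∂μ) atTop (𝓝 0)) :
    Tendsto (fun n => ∫ x, ‖fn n x‖ ^ 2 ∂μ) atTop (𝓝 (∫ x, ‖f x‖ ^ 2 ∂μ)) := by
  have h1 := ((Lp.tendsto_Lp_iff_tendsto_eLpNorm'' fn hfn f hf).2
    (tendsto_eLpNorm_two h)).norm.pow 2
  simp only [Lp.norm_toLp] at h1
  simpa only [integral_norm_sq_eq hf.1, integral_norm_sq_eq (hfn _).1] using h1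

end Ltwo

theorem neg_one_le_mul_log {t : ℝ} (ht : 0 ≤ t) : -1 ≤ t * Real.log t := by
  rcases ht.eq_or_lt with rfl | h
  · simp
  · have h2 := mul_le_mul_of_nonneg_left (Real.one_sub_inv_le_log_of_pos h) ht
    rw [mul_sub, mul_inv_cancel₀ h.ne'] at h2
    linarith

/-- The scaled inequality passes to limits of test functions supported in a fixed ball: there the
entropy integrand is bounded below by an integrable function and Fatou's lemma applies. -/
theorem logSobolev_of_tendsto {n : ℕ} {ψ : ℕ → EuclideanSpace ℝ (Fin n) → ℝ}
    {v : EuclideanSpace ℝ (Fin n) → ℝ} {G : EuclideanSpace ℝ (Fin n) → EuclideanSpace ℝ (Fin n)}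
    {B : Set (EuclideanSpace ℝ (Fin n))} (hBfin : volume B ≠ ⊤)
    (hψ : ∀ k, ContDiff ℝ 1 (ψ k)) (hψs : ∀ k, HasCompactSupport (ψ k))
    (hψB : ∀ k, ∀ x ∉ B, ψ k x = 0) (hvB : ∀ x ∉ B, v x = 0) (hv : AEStronglyMeasurable v volume)
    (hG : AEStronglyMeasurable G volume)
    (hlimG : Tendsto (fun k => ∫⁻ x, ENNReal.ofReal (‖gradient (ψ k) x - G x‖ ^ 2)) atTop (𝓝 0))
    (hlim : Tendsto (fun k => ∫⁻ x, ENNReal.ofReal (‖ψ k x - v x‖ ^ 2)) atTop (𝓝 0))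
    (hent : Integrable fun x => v x ^ 2 * Real.log (v x ^ 2)) {r : ℝ} (hr : 0 < r) :
    ∫ x, v x ^ 2 * Real.log (v x ^ 2) ≤ (∫ x, v x ^ 2) * Real.log (∫ x, v x ^ 2) -
      (n * Real.log r + n / 2 * Real.log (2 * Real.pi) + n) * (∫ x, v x ^ 2) +
      2 * r ^ 2 * ∫ x, ‖G x‖ ^ 2 := by
  have hψL : ∀ k, MemLp (ψ k) 2 (volume : Measure (EuclideanSpace ℝ (Fin n))) := fun k =>
    (hψ k).continuous.memLp_of_hasCompactSupport (hψs k)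
  have hgL : ∀ k, MemLp (gradient (ψ k)) 2 (volume : Measure (EuclideanSpace ℝ (Fin n))) :=
    fun k => (continuous_gradient (hψ k) one_ne_zero).memLp_of_hasCompactSupport (hψs k).gradient
  have hvL := memLp_two_of_tendsto hψL hv hlim
  have hGL := memLp_two_of_tendsto hgL hG hlimG
  have hm := tendsto_integral_norm_sq hψL hvL hlim
  have hI := tendsto_integral_norm_sq hgL hGL hlimG
  simp only [Real.norm_eq_abs, sq_abs] at hm
  obtain ⟨ns, hns, hae⟩ := (tendstoInMeasure_of_tendsto_eLpNorm two_ne_zero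
    (fun k => (hψL k).1) hvL.1 (tendsto_eLpNorm_two hlim)).exists_seq_tendsto_ae
  set K := n * Real.log r + n / 2 * Real.log (2 * Real.pi) + n with hK
  set b := volume.real B with hb
  have hentψ : ∀ k, Integrable fun x => ψ k x ^ 2 * Real.log (ψ k x ^ 2) := fun k =>
    (Real.continuous_mul_log.comp ((hψ k).continuous.pow 2)).integrable_of_hasCompactSupport
      ((hψs k).of_imp fun x hx => by simp [hx])
  have split : ∀ f : EuclideanSpace ℝ (Fin n) → ℝ, (∀ x ∉ B, f x = 0) →
      Integrable (fun x => f x ^ 2 * Real.log (f x ^ 2)) →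
      ∫⁻ x in B, ENNReal.ofReal (f x ^ 2 * Real.log (f x ^ 2) + 1) =
        ENNReal.ofReal ((∫ x, f x ^ 2 * Real.log (f x ^ 2)) + b) ∧
      0 ≤ (∫ x, f x ^ 2 * Real.log (f x ^ 2)) + b := by
    intro f hf hfi
    have i1 : Integrable (fun _ => (1 : ℝ)) (volume.restrict B) :=
      integrableOn_const (hs := hBfin)
    have e1 : ∫ x in B, (f x ^ 2 * Real.log (f x ^ 2) + 1) =
        (∫ x, f x ^ 2 * Real.log (f x ^ 2)) + b := by
      rw [integral_add hfi.restrict i1, setIntegral_eq_integral_of_forall_compl_eq_zero]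
      · simp [hb]
      · intro x hx; simp [hf x hx]
    have nn : ∀ x, 0 ≤ f x ^ 2 * Real.log (f x ^ 2) + 1 := fun x => by
      linarith [neg_one_le_mul_log (sq_nonneg (f x))]
    rw [← e1]
    exact ⟨(ofReal_integral_eq_lintegral_ofReal (hfi.restrict.add i1)
      (Eventually.of_forall nn)).symm, integral_nonneg nn⟩
  have hR : Tendsto (fun k => (∫ x, ψ (ns k) x ^ 2) * Real.log (∫ x, ψ (ns k) x ^ 2) -
      K * (∫ x, ψ (ns k) x ^ 2) + 2 * r ^ 2 * (∫ x, ‖gradient (ψ (ns k)) x‖ ^ 2) + b) atTop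
      (𝓝 ((∫ x, v x ^ 2) * Real.log (∫ x, v x ^ 2) - K * (∫ x, v x ^ 2) +
        2 * r ^ 2 * (∫ x, ‖G x‖ ^ 2) + b)) := by
    have m' := hm.comp hns.tendsto_atTop
    have I' := hI.comp hns.tendsto_atTop
    exact ((((Real.continuous_mul_log.tendsto _).comp m').sub (m'.const_mul K)).add
      (I'.const_mul _)).add_const b
  have hle : ∀ k, (∫ x, ψ (ns k) x ^ 2 * Real.log (ψ (ns k) x ^ 2)) + b ≤
      (∫ x, ψ (ns k) x ^ 2) * Real.log (∫ x, ψ (ns k) x ^ 2) -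
      K * (∫ x, ψ (ns k) x ^ 2) + 2 * r ^ 2 * (∫ x, ‖gradient (ψ (ns k)) x‖ ^ 2) + b := fun k => by
    have := logSobolev_test_scaled (hψ (ns k)) (hψs (ns k)) hr
    rw [← hK] at this
    linarith
  have hR0 := ge_of_tendsto' hR fun k =>
    (split (ψ (ns k)) (hψB _) (hentψ _)).2.trans (hle k)
  have hfatou : ∫⁻ x in B, ENNReal.ofReal (v x ^ 2 * Real.log (v x ^ 2) + 1) ≤
      liminf (fun k => ∫⁻ x in B,
        ENNReal.ofReal (ψ (ns k) x ^ 2 * Real.log (ψ (ns k) x ^ 2) + 1)) atTop := by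
    refine le_trans (lintegral_mono_ae ?_) (lintegral_liminf_le' fun k => ?_)
    · filter_upwards [ae_restrict_of_ae hae] with x hx
      have hcont : Continuous fun t : ℝ => ENNReal.ofReal (t ^ 2 * Real.log (t ^ 2) + 1) :=
        ENNReal.continuous_ofReal.comp
          ((Real.continuous_mul_log.comp (continuous_pow 2)).add continuous_const)
      exact (((hcont.tendsto _).comp hx).liminf_eq).ge
    · exact ((hentψ (ns k)).1.aemeasurable.add_const 1).ennreal_ofReal.restrict
  rw [(split v hvB hent).1] at hfatou
  have h2 : liminf (fun k => ∫⁻ x in B,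
      ENNReal.ofReal (ψ (ns k) x ^ 2 * Real.log (ψ (ns k) x ^ 2) + 1)) atTop ≤
      ENNReal.ofReal ((∫ x, v x ^ 2) * Real.log (∫ x, v x ^ 2) - K * (∫ x, v x ^ 2) +
        2 * r ^ 2 * (∫ x, ‖G x‖ ^ 2) + b) := by
    rw [← (ENNReal.tendsto_ofReal hR).liminf_eq]
    refine liminf_le_liminf (Eventually.of_forall fun k => ?_)
    rw [(split (ψ (ns k)) (hψB _) (hentψ _)).1]
    exact ENNReal.ofReal_le_ofReal (hle k)
  have h3 := (ENNReal.ofReal_le_ofReal_iff hR0).1 (hfatou.trans h2)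
  linarith

/-- Domination of the entropy integrand of a truncated function by that of the function itself. -/
theorem abs_mul_log_mul_le {s t : ℝ} (hs0 : 0 ≤ s) (hs1 : s ≤ 1) (ht : 0 ≤ t) :
    |s * t * Real.log (s * t)| ≤ |t * Real.log t| + t := by
  rcases hs0.eq_or_lt with rfl | hs
  · simpa using by positivity
  rcases ht.eq_or_lt with rfl | ht'
  · simp
  have e : s * t * Real.log (s * t) = s * (t * Real.log t) + t * (s * Real.log s) := by
    rw [Real.log_mul hs.ne' ht'.ne']; ring
  have h1 : |s * Real.log s| ≤ 1 := by
    rw [abs_le]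
    exact ⟨neg_one_le_mul_log hs0, (mul_nonpos_of_nonneg_of_nonpos hs0
      (Real.log_nonpos hs0 hs1)).trans zero_le_one⟩
  rw [e]
  refine (abs_add_le _ _).trans (add_le_add ?_ ?_)
  · rw [abs_mul, abs_of_nonneg hs0]
    exact mul_le_of_le_one_left (abs_nonneg _) hs1
  · rw [abs_mul, abs_of_nonneg ht]
    exact mul_le_of_le_one_right ht h1

/-- The scaled logarithmic Sobolev inequality on `H¹`. The cutoffs keep mass from escaping to
infinity, where the entropy is not lower semicontinuous. -/
theorem MemH1.logSobolev {n : ℕ} {u : EuclideanSpace ℝ (Fin n) → ℝ}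
    {g : EuclideanSpace ℝ (Fin n) → EuclideanSpace ℝ (Fin n)} (hu : MemH1 u g)
    (hu1 : ∫ x, u x ^ 2 = 1) (hent : Integrable fun x => u x ^ 2 * Real.log (u x ^ 2))
    {r : ℝ} (hr : 0 < r) :
    ∫ x, u x ^ 2 * Real.log (u x ^ 2) ≤
      -(n * Real.log r + n / 2 * Real.log (2 * Real.pi) + n) + 2 * r ^ 2 * ∫ x, ‖g x‖ ^ 2 := by
  obtain ⟨hum, hgm, φ, hφ, hlimg, hlimu⟩ := hu
  simp only [mul_zero, Real.rpow_zero, one_mul] at hlimg hlimu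
  have hlimu' : Tendsto (fun k => ∫⁻ x, ENNReal.ofReal (‖φ k x - u x‖ ^ 2)) atTop (𝓝 0) := by
    simpa only [Real.norm_eq_abs, sq_abs] using hlimu
  have hφ1 : ∀ k, ContDiff ℝ 1 (φ k) := fun k => (hφ k).1.of_le (by simp)
  have hgL : MemLp g 2 volume := memLp_two_of_tendsto
    (fun k => (continuous_gradient (hφ1 k) one_ne_zero).memLp_of_hasCompactSupport
      (hφ k).2.1.gradient) hgm hlimg
  have hg2 : Integrable fun x => ‖g x‖ ^ 2 := hgL.integrable_norm_pow two_ne_zero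
  have hu2 : Integrable fun x => u x ^ 2 := by
    by_contra h
    rw [integral_undef h] at hu1
    exact zero_ne_one hu1
  obtain ⟨C, χ, hχ⟩ := exists_isCutoffSeq_univ (E := EuclideanSpace ℝ (Fin n))
  have hχc : ∀ k, Continuous (χ k) := fun k => (hχ.contDiff k).continuous
  have hχg : ∀ k, Continuous (gradient (χ k)) := fun k =>
    continuous_gradient (hχ.contDiff k) (by simp)
  have hχ2 : ∀ k x, χ k x ^ 2 ≤ 1 := fun k x => pow_le_one₀ (hχ.nonneg k x) (hχ.le_one k x)
  have hχe : ∀ x, ∀ᶠ k in atTop, χ k x = 1 := fun x => hχ.eventually_eq_one x (Set.mem_univ x)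
  have hgχ2 : ∀ k x, ‖gradient (χ k) x‖ ^ 2 ≤ C ^ 2 := fun k x =>
    pow_le_pow_left₀ (norm_nonneg _) (hχ.norm_gradient_le' k x) 2
  set v : ℕ → EuclideanSpace ℝ (Fin n) → ℝ := fun k x => χ k x * u x with hv
  set G : ℕ → EuclideanSpace ℝ (Fin n) → EuclideanSpace ℝ (Fin n) :=
    fun k x => χ k x • g x + u x • gradient (χ k) x with hG
  have hvm : ∀ k, AEStronglyMeasurable (v k) volume := fun k =>
    (hχc k).aestronglyMeasurable.mul hum
  have hGm : ∀ k, AEStronglyMeasurable (G k) volume := fun k =>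
    ((hχc k).aestronglyMeasurable.smul hgm).add (hum.smul (hχg k).aestronglyMeasurable)
  have hvent : ∀ k x, ‖v k x ^ 2 * Real.log (v k x ^ 2)‖ ≤
      |u x ^ 2 * Real.log (u x ^ 2)| + u x ^ 2 := fun k x => by
    rw [Real.norm_eq_abs]
    simp only [hv, mul_pow]
    exact abs_mul_log_mul_le (sq_nonneg _) (hχ2 k x) (sq_nonneg _)
  have hventm : ∀ k, AEStronglyMeasurable (fun x => v k x ^ 2 * Real.log (v k x ^ 2)) volume :=
    fun k => Real.continuous_mul_log.comp_aestronglyMeasurable ((hvm k).pow 2)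
  have hdom : Integrable fun x => |u x ^ 2 * Real.log (u x ^ 2)| + u x ^ 2 := hent.abs.add hu2
  have hGdom : ∀ k x, ‖‖G k x‖ ^ 2‖ ≤ 2 * ‖g x‖ ^ 2 + 2 * (C ^ 2 * u x ^ 2) := fun k x => by
    rw [Real.norm_of_nonneg (sq_nonneg _)]
    refine norm_smul_add_smul_sq_le.trans ?_
    have h1 := mul_le_mul_of_nonneg_right (hχ2 k x) (sq_nonneg ‖g x‖)
    have h2 := mul_le_mul_of_nonneg_left (hgχ2 k x) (sq_nonneg (u x))
    linarith
  -- the inequality for the truncated functions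
  have hk : ∀ k, ∫ x, v k x ^ 2 * Real.log (v k x ^ 2) ≤
      (∫ x, v k x ^ 2) * Real.log (∫ x, v k x ^ 2) -
      (n * Real.log r + n / 2 * Real.log (2 * Real.pi) + n) * (∫ x, v k x ^ 2) +
      2 * r ^ 2 * ∫ x, ‖G k x‖ ^ 2 := by
    intro k
    have hgrad : ∀ j x, gradient (fun y => χ k y * φ j y) x =
        χ k x • gradient (φ j) x + φ j x • gradient (χ k) x := fun j x =>
      gradient_fun_mul ((hχ.contDiff k).differentiable (by simp) x)
        ((hφ1 j).differentiable one_ne_zero x)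
    refine logSobolev_of_tendsto (ψ := fun j x => χ k x * φ j x) (B := tsupport (χ k))
      (hχ.hasCompactSupport k).isCompact.measure_lt_top.ne
      (fun j => ((hχ.contDiff k).of_le (by simp)).mul (hφ1 j))
      (fun j => (hχ.hasCompactSupport k).mul_right)
      (fun j x hx => by simp [image_eq_zero_of_notMem_tsupport hx])
      (fun x hx => by simp [hv, image_eq_zero_of_notMem_tsupport hx]) (hvm k) (hGm k) ?_ ?_
      (hdom.mono' (hventm k) (Eventually.of_forall (hvent k))) hr
    · have hb : Tendsto (fun j => ENNReal.ofReal 2 *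
          (∫⁻ x, ENNReal.ofReal (‖gradient (φ j) x - g x‖ ^ 2)) +
          ENNReal.ofReal (2 * C ^ 2) * ∫⁻ x, ENNReal.ofReal (‖φ j x - u x‖ ^ 2)) atTop (𝓝 0) := by
        have := (ENNReal.Tendsto.const_mul (a := ENNReal.ofReal 2) hlimg
          (Or.inr ENNReal.ofReal_ne_top)).add
          (ENNReal.Tendsto.const_mul (a := ENNReal.ofReal (2 * C ^ 2)) hlimu'
            (Or.inr ENNReal.ofReal_ne_top))
        simpa using this
      refine tendsto_of_tendsto_of_tendsto_of_le_of_le tendsto_const_nhds hb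
        (fun _ => zero_le) fun j => ?_
      have m1 : AEMeasurable (fun x => ENNReal.ofReal (‖gradient (φ j) x - g x‖ ^ 2)) volume :=
        (((continuous_gradient (hφ1 j) one_ne_zero).aestronglyMeasurable.sub
          hgm).norm.pow 2).aemeasurable.ennreal_ofReal
      simp only
      rw [← lintegral_const_mul'' _ m1, ← lintegral_const_mul' _ _ ENNReal.ofReal_ne_top,
        ← lintegral_add_left' (m1.const_mul _)]
      refine lintegral_mono fun x => ?_
      simp only
      rw [hgrad, ← ENNReal.ofReal_mul (by positivity),
        ← ENNReal.ofReal_mul (by positivity), ← ENNReal.ofReal_add (by positivity) (by positivity)]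
      refine ENNReal.ofReal_le_ofReal ?_
      have e : χ k x • gradient (φ j) x + φ j x • gradient (χ k) x - G k x =
          χ k x • (gradient (φ j) x - g x) + (φ j x - u x) • gradient (χ k) x := by
        simp only [hG]; module
      rw [e]
      refine norm_smul_add_smul_sq_le.trans ?_
      have h1 := mul_le_mul_of_nonneg_right (hχ2 k x) (sq_nonneg ‖gradient (φ j) x - g x‖)
      have h2 := mul_le_mul_of_nonneg_left (hgχ2 k x) (sq_nonneg (φ j x - u x))
      rw [Real.norm_eq_abs (φ j x - u x), sq_abs]
      linarith
    · refine tendsto_of_tendsto_of_tendsto_of_le_of_le tendsto_const_nhds hlimu'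
        (fun _ => zero_le) fun j => lintegral_mono fun x => ENNReal.ofReal_le_ofReal ?_
      rw [show χ k x * φ j x - v k x = χ k x * (φ j x - u x) by simp only [hv]; ring, norm_mul,
        mul_pow, Real.norm_eq_abs (χ k x), sq_abs]
      exact mul_le_of_le_one_left (sq_nonneg _) (hχ2 k x)
  have hL1 : Tendsto (fun k => ∫ x, v k x ^ 2) atTop (𝓝 1) := by
    rw [← hu1]
    refine tendsto_integral_of_dominated_convergence (fun x => u x ^ 2)
      (fun k => (hvm k).pow 2) hu2 (fun k => Eventually.of_forall fun x => ?_)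
      (Eventually.of_forall fun x => ?_)
    · rw [Real.norm_of_nonneg (sq_nonneg _)]
      simp only [hv, mul_pow]
      exact mul_le_of_le_one_left (sq_nonneg _) (hχ2 k x)
    · exact tendsto_const_nhds.congr' ((hχe x).mono fun k hk => by simp [hv, hk])
  have hL2 : Tendsto (fun k => ∫ x, v k x ^ 2 * Real.log (v k x ^ 2)) atTop
      (𝓝 (∫ x, u x ^ 2 * Real.log (u x ^ 2))) := by
    refine tendsto_integral_of_dominated_convergence _ hventm hdom
      (fun k => Eventually.of_forall (hvent k)) (Eventually.of_forall fun x => ?_)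
    exact tendsto_const_nhds.congr' ((hχe x).mono fun k hk => by simp [hv, hk])
  have hL3 : Tendsto (fun k => ∫ x, ‖G k x‖ ^ 2) atTop (𝓝 (∫ x, ‖g x‖ ^ 2)) := by
    refine tendsto_integral_of_dominated_convergence _ (fun k => (hGm k).norm.pow 2)
      ((hg2.const_mul 2).add ((hu2.const_mul _).const_mul 2))
      (fun k => Eventually.of_forall (hGdom k)) (Eventually.of_forall fun x => ?_)
    have h1 : Tendsto (fun k => χ k x) atTop (𝓝 1) :=
      tendsto_const_nhds.congr' ((hχe x).mono fun k hk => hk.symm)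
    have h2 := ((h1.smul_const (g x)).add ((hχ.tendsto_gradient x).const_smul (u x))).norm.pow 2
    simpa using h2
  have hR := (((Real.continuous_mul_log.tendsto _).comp hL1).sub
    (hL1.const_mul (n * Real.log r + n / 2 * Real.log (2 * Real.pi) + n))).add
    (hL3.const_mul (2 * r ^ 2))
  refine (le_of_tendsto_of_tendsto' hL2 hR hk).trans_eq ?_
  simp

/-- The scale invariant inequality, by optimizing the scale `r`. If the gradient vanished, letting
`r → ∞` would force the entropy to be `-∞`. -/
theorem lsHolds_two_div {d : ℕ} (hd : 0 < d) :
    LSHolds d (2 / (Real.pi * d * Real.exp 1)) := by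
  intro u g hu hu1 hent
  set S := ∫ x, u x ^ 2 * Real.log (u x ^ 2) with hS
  set I := ∫ x, ‖g x‖ ^ 2 with hI
  have hd' : (0 : ℝ) < d := by exact_mod_cast hd
  have hI0 : 0 ≤ I := integral_nonneg fun x => sq_nonneg _
  have key : ∀ r : ℝ, 0 < r → S ≤
      -(d * Real.log r + d / 2 * Real.log (2 * Real.pi) + d) + 2 * r ^ 2 * I :=
    fun r hr => hu.logSobolev hu1 hent hr
  rcases hI0.eq_or_lt with h0 | hIpos
  · exfalso
    have := key (Real.exp ((-S - d / 2 * Real.log (2 * Real.pi)) / d)) (Real.exp_pos _)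
    rw [← h0, Real.log_exp, mul_div_cancel₀ _ hd'.ne'] at this
    linarith
  · -- the optimal scale
    have h := key (√(d / (4 * I))) (by positivity)
    rw [Real.sq_sqrt (by positivity), Real.log_sqrt (by positivity),
      Real.log_div hd'.ne' (by positivity), Real.log_mul (by norm_num) hIpos.ne',
      Real.log_mul two_ne_zero Real.pi_ne_zero] at h
    have e1 : 2 * (d / (4 * I)) * I = (d : ℝ) / 2 := by field_simp; norm_num
    rw [e1] at h
    have hpos : 0 < 2 / (Real.pi * d * Real.exp 1) * I := by positivity
    rw [← Real.exp_log hpos]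
    refine Real.exp_le_exp.2 ?_
    rw [Real.log_mul (by positivity) hIpos.ne', Real.log_div two_ne_zero (by positivity),
      Real.log_mul (by positivity) (Real.exp_pos 1).ne', Real.log_mul Real.pi_ne_zero hd'.ne',
      Real.log_exp, div_mul_eq_mul_div, div_le_iff₀ hd']
    have e2 : Real.log 4 = 2 * Real.log 2 := by
      rw [show (4 : ℝ) = 2 ^ 2 by norm_num, Real.log_pow]; norm_num
    rw [e2] at h
    nlinarith

/-! ### Smooth functions as Sobolev limits, and the Gaussian -/

theorem measurable_gradient {d : ℕ} (u : EuclideanSpace ℝ (Fin d) → ℝ) : Measurable (gradient u) :=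
  (InnerProductSpace.toDual ℝ (EuclideanSpace ℝ (Fin d))).symm.continuous.measurable.comp
    (measurable_fderiv ℝ u)

/-- A function that is smooth on `Ω` and has finite weighted norms belongs to the completion as soon
as there are cutoff functions whose gradients are compatible with the weights. -/
theorem isSobolevLimit_of_isCutoffSeq {d : ℕ} {Ω : Set (EuclideanSpace ℝ (Fin d))}
    (hΩ : IsOpen Ω) (hΩ0 : volume Ωᶜ = 0) {α β C : ℝ} {u : EuclideanSpace ℝ (Fin d) → ℝ}
    (hu : ContDiffOn ℝ ∞ u Ω) (hum : AEStronglyMeasurable u volume)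
    (h1 : Integrable fun x => ‖x‖ ^ (-2 * α) * ‖gradient u x‖ ^ 2)
    (h2 : Integrable fun x => ‖x‖ ^ (-2 * β) * u x ^ 2)
    {χ : ℕ → EuclideanSpace ℝ (Fin d) → ℝ} {ρ : EuclideanSpace ℝ (Fin d) → ℝ}
    (hχ : IsCutoffSeq Ω ρ χ)
    (hρ : ∀ x ∈ Ω, ‖x‖ ^ (-2 * α) * ρ x ^ 2 ≤ C * ‖x‖ ^ (-2 * β)) :
    IsSobolevLimit Ω α β u (gradient u) := by
  have hgm := measurable_gradient u
  have hsub : ∀ k, tsupport (fun x => χ k x * u x) ⊆ tsupport (χ k) := fun k =>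
    tsupport_mul_subset_left
  have hφ : ∀ k, ContDiff ℝ ∞ fun x => χ k x * u x := fun k => by
    refine contDiff_iff_contDiffAt.2 fun x => ?_
    by_cases hx : x ∈ tsupport (χ k)
    · have hxΩ := hχ.tsupport_subset k hx
      exact (hχ.contDiff k).contDiffAt.mul ((hu x hxΩ).contDiffAt (hΩ.mem_nhds hxΩ))
    · refine (contDiffAt_const (c := (0 : ℝ))).congr_of_eventuallyEq ?_
      filter_upwards [notMem_tsupport_iff_eventuallyEq.1 hx] with y hy
      rw [hy]; simp
  have haeΩ : ∀ᵐ x ∂(volume : Measure (EuclideanSpace ℝ (Fin d))), x ∈ Ω := by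
    rw [ae_iff]; exact hΩ0
  have hgrad : ∀ k, ∀ x ∈ Ω, gradient (fun y => χ k y * u y) x - gradient u x =
      (χ k x - 1) • gradient u x + u x • gradient (χ k) x := fun k x hx => by
    rw [gradient_fun_mul ((hχ.contDiff k).differentiable (by simp) x)
      (((hu x hx).contDiffAt (hΩ.mem_nhds hx)).differentiableAt (by simp))]
    module
  have hχ1 : ∀ k x, (χ k x - 1) ^ 2 ≤ 1 := fun k x => by
    have := hχ.nonneg k x; have := hχ.le_one k x; nlinarith
  have hw : ∀ (s : ℝ) (x : EuclideanSpace ℝ (Fin d)), 0 ≤ ‖x‖ ^ s := fun s x =>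
    Real.rpow_nonneg (norm_nonneg _) _
  have hone : ∀ x ∈ Ω, Tendsto (fun k => χ k x) atTop (𝓝 1) := fun x hx =>
    tendsto_const_nhds.congr' ((hχ.eventually_eq_one x hx).mono fun k hk => hk.symm)
  refine ⟨hum, hgm.aestronglyMeasurable, fun k x => χ k x * u x, fun k => ⟨hφ k,
    (hχ.hasCompactSupport k).mul_right, (hsub k).trans (hχ.tsupport_subset k)⟩, ?_, ?_⟩
  · have h0 : (0 : ℝ≥0∞) = ∫⁻ _ : EuclideanSpace ℝ (Fin d), 0 := by simp
    rw [h0]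
    have hbi : Integrable fun x : EuclideanSpace ℝ (Fin d) => 2 * (‖x‖ ^ (-2 * α) *
        ‖gradient u x‖ ^ 2) + 2 * C * (‖x‖ ^ (-2 * β) * u x ^ 2) :=
      (h1.const_mul 2).add (h2.const_mul (2 * C))
    refine tendsto_lintegral_of_dominated_convergence' (fun x => ENNReal.ofReal (2 *
      (‖x‖ ^ (-2 * α) * ‖gradient u x‖ ^ 2) + 2 * C * (‖x‖ ^ (-2 * β) * u x ^ 2)))
      (fun k => ?_) (fun k => ?_) hbi.lintegral_lt_top.ne ?_
    · have hm := (continuous_gradient (hφ k) (by simp)).measurable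
      exact ((measurable_norm.pow_const _).mul
        ((hm.sub hgm).norm.pow_const 2)).ennreal_ofReal.aemeasurable
    · filter_upwards [haeΩ] with x hx
      refine ENNReal.ofReal_le_ofReal ?_
      rw [hgrad k x hx]
      refine (mul_le_mul_of_nonneg_left norm_smul_add_smul_sq_le (hw _ x)).trans ?_
      have e1 := mul_le_mul_of_nonneg_left (hχ1 k x)
        (mul_nonneg (hw (-2 * α) x) (sq_nonneg ‖gradient u x‖))
      have e2 := mul_le_mul_of_nonneg_left
        (pow_le_pow_left₀ (norm_nonneg _) (hχ.norm_gradient_le' k x) 2)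
        (mul_nonneg (hw (-2 * α) x) (sq_nonneg (u x)))
      have e3 := mul_le_mul_of_nonneg_right (hρ x hx) (sq_nonneg (u x))
      nlinarith
    · filter_upwards [haeΩ] with x hx
      have l1 : Tendsto (fun k => ‖x‖ ^ (-2 * α) *
          ‖(χ k x - 1) • gradient u x + u x • gradient (χ k) x‖ ^ 2) atTop (𝓝 0) := by
        have := (((((hone x hx).sub_const 1).smul_const (gradient u x)).add
          ((hχ.tendsto_gradient x).const_smul (u x))).norm.pow 2).const_mul (‖x‖ ^ (-2 * α))
        simpa using this
      have l2 := ENNReal.tendsto_ofReal l1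
      rw [ENNReal.ofReal_zero] at l2
      simpa only [hgrad _ x hx] using l2
  · have h0 : (0 : ℝ≥0∞) = ∫⁻ _ : EuclideanSpace ℝ (Fin d), 0 := by simp
    rw [h0]
    have e : ∀ k x, χ k x * u x - u x = (χ k x - 1) * u x := fun k x => by ring
    simp only [e, mul_pow]
    refine tendsto_lintegral_of_dominated_convergence' (fun x => ENNReal.ofReal
      (‖x‖ ^ (-2 * β) * u x ^ 2)) (fun k => ?_) (fun k => ?_) h2.lintegral_lt_top.ne ?_
    · have hm := (hχ.contDiff k).continuous.measurable
      exact ((measurable_norm.pow_const _).aemeasurable.mul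
        (((hm.sub_const 1).pow_const 2).aemeasurable.mul
          (hum.aemeasurable.pow_const 2))).ennreal_ofReal
    · refine Eventually.of_forall fun x => ENNReal.ofReal_le_ofReal ?_
      exact mul_le_mul_of_nonneg_left (mul_le_of_le_one_left (sq_nonneg _) (hχ1 k x)) (hw _ x)
    · filter_upwards [haeΩ] with x hx
      have l1 : Tendsto (fun k => ‖x‖ ^ (-2 * β) * ((χ k x - 1) ^ 2 * u x ^ 2)) atTop (𝓝 0) := by
        have := ((((hone x hx).sub_const 1).pow 2).mul_const (u x ^ 2)).const_mul (‖x‖ ^ (-2 * β))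
        simpa using this
      have l2 := ENNReal.tendsto_ofReal l1
      rwa [ENNReal.ofReal_zero] at l2

theorem gradient_comp_hasDerivAt {E : Type*} [NormedAddCommGroup E] [InnerProductSpace ℝ E]
    [CompleteSpace E] {f : ℝ → ℝ} {f' : ℝ} {h : E → ℝ} {x : E} (hf : HasDerivAt f f' (h x))
    (hh : DifferentiableAt ℝ h x) :
    gradient (fun y => f (h y)) x = f' • gradient h x := by
  refine HasGradientAt.gradient (hasGradientAt_iff_hasFDerivAt.2 ?_)
  refine (hf.comp_hasFDerivAt x hh.hasFDerivAt).congr_fderiv ?_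
  rw [map_smul, toDual_gradient]

theorem gradient_norm_sq {E : Type*} [NormedAddCommGroup E] [InnerProductSpace ℝ E]
    [CompleteSpace E] (x : E) : gradient (fun y : E => ‖y‖ ^ 2) x = (2 : ℝ) • x := by
  refine HasGradientAt.gradient (hasGradientAt_iff_hasFDerivAt.2 ?_)
  refine (hasStrictFDerivAt_norm_sq x).hasFDerivAt.congr_fderiv ?_
  ext v; simp

/-- The square root of the standard Gaussian density, the optimal function in the logarithmic
Sobolev inequality. -/
noncomputable def sqrtGaussian (d : ℕ) (x : EuclideanSpace ℝ (Fin d)) : ℝ :=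
  Real.exp (-(d / 4 * Real.log (2 * Real.pi)) - ‖x‖ ^ 2 / 4)

theorem sqrtGaussian_sq {d : ℕ} (x : EuclideanSpace ℝ (Fin d)) :
    sqrtGaussian d x ^ 2 = Real.exp (-(d / 2 * Real.log (2 * Real.pi)) - ‖x‖ ^ 2 / 2) := by
  rw [sqrtGaussian, ← Real.exp_nat_mul]
  congr 1; push_cast; ring

theorem integral_sqrtGaussian_sq_mul {d : ℕ} (f : EuclideanSpace ℝ (Fin d) → ℝ) :
    ∫ x, sqrtGaussian d x ^ 2 * f x = ∫ x, f (WithLp.toLp 2 x) ∂(gaussianPi d) := by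
  rw [integral_gaussianPi_eq, ← (PiLp.volume_preserving_toLp (Fin d)).integral_comp
      (MeasurableEquiv.toLp 2 (Fin d → ℝ)).measurableEmbedding]
  refine integral_congr_ae (Eventually.of_forall fun x => ?_)
  simp only
  rw [sqrtGaussian_sq, ← Real.exp_log (prod_gaussianPDFReal_pos x), log_prod_gaussianPDFReal,
    EuclideanSpace.norm_sq_eq]
  simp

theorem integral_sqrtGaussian_sq (d : ℕ) : ∫ x, sqrtGaussian d x ^ 2 = 1 := by
  have := integral_sqrtGaussian_sq_mul (d := d) fun _ => 1
  simpa using this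

theorem integral_sqrtGaussian_sq_mul_norm_sq (d : ℕ) :
    ∫ x, sqrtGaussian d x ^ 2 * ‖x‖ ^ 2 = d := by
  have hi : Integrable (fun t : ℝ => t ^ 2) (ProbabilityTheory.gaussianReal 0 1) := by
    have := ProbabilityTheory.memLp_id_gaussianReal (μ := 0) (v := 1) 2
    exact this.integrable_sq
  have h1 : ∫ t, t ^ 2 ∂(ProbabilityTheory.gaussianReal 0 1) = 1 := by
    rw [ProbabilityTheory.integral_gaussianReal_eq_integral_smul one_ne_zero,
      ← integral_sq_mul_gaussianPDFReal]
    simp [mul_comm]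
  have hmp := fun i : Fin d => measurePreserving_eval
    (fun _ : Fin d => ProbabilityTheory.gaussianReal 0 1) i
  rw [integral_sqrtGaussian_sq_mul]
  simp only [EuclideanSpace.norm_sq_eq, Real.norm_eq_abs, sq_abs]
  have hi' : ∀ i : Fin d, Integrable (fun x : Fin d → ℝ => x i ^ 2) (gaussianPi d) := fun i =>
    (hmp i).integrable_comp_of_integrable hi
  rw [integral_finsetSum _ fun i _ => hi' i]
  have h2 : ∀ i, ∫ x, x i ^ 2 ∂(gaussianPi d) = 1 := fun i => by
    rw [← h1, ← (hmp i).map_eq, integral_map (hmp i).measurable.aemeasurable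
      (by fun_prop)]
  simp [h2]

theorem gradient_sqrtGaussian {d : ℕ} (x : EuclideanSpace ℝ (Fin d)) :
    gradient (sqrtGaussian d) x = (-(sqrtGaussian d x / 2)) • x := by
  have h1 : HasDerivAt (fun t : ℝ => Real.exp (-(d / 4 * Real.log (2 * Real.pi)) - t / 4))
      (sqrtGaussian d x * (-(1 / 4))) (‖x‖ ^ 2) :=
    (((hasDerivAt_id _).div_const 4).const_sub _).exp
  have h2 := gradient_comp_hasDerivAt (h := fun y : EuclideanSpace ℝ (Fin d) => ‖y‖ ^ 2) h1
    (hasStrictFDerivAt_norm_sq x).hasFDerivAt.differentiableAt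
  rw [gradient_norm_sq, smul_smul] at h2
  refine h2.trans ?_
  congr 1; ring

theorem norm_gradient_sqrtGaussian_sq {d : ℕ} (x : EuclideanSpace ℝ (Fin d)) :
    ‖gradient (sqrtGaussian d) x‖ ^ 2 = 1 / 4 * (sqrtGaussian d x ^ 2 * ‖x‖ ^ 2) := by
  rw [gradient_sqrtGaussian, norm_smul, mul_pow, Real.norm_eq_abs, sq_abs]
  ring

theorem integrable_sqrtGaussian_sq (d : ℕ) : Integrable fun x => sqrtGaussian d x ^ 2 :=
  .of_integral_ne_zero (by rw [integral_sqrtGaussian_sq]; exact one_ne_zero)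

theorem integrable_sqrtGaussian_sq_mul_norm_sq {d : ℕ} (hd : 0 < d) :
    Integrable fun x => sqrtGaussian d x ^ 2 * ‖x‖ ^ 2 :=
  .of_integral_ne_zero (by
    rw [integral_sqrtGaussian_sq_mul_norm_sq]; exact_mod_cast hd.ne')

theorem memH1_sqrtGaussian {d : ℕ} (hd : 0 < d) :
    MemH1 (sqrtGaussian d) (gradient (sqrtGaussian d)) := by
  obtain ⟨C, χ, hχ⟩ := exists_isCutoffSeq_univ (E := EuclideanSpace ℝ (Fin d))
  have hc : ContDiff ℝ ∞ (sqrtGaussian d) := by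
    have : ContDiff ℝ ∞ fun x : EuclideanSpace ℝ (Fin d) => ‖x‖ ^ 2 := contDiff_norm_sq ℝ
    exact (contDiff_const.sub (this.div_const 4)).exp
  refine isSobolevLimit_of_isCutoffSeq (C := C ^ 2) isOpen_univ (by simp) hc.contDiffOn
    hc.continuous.aestronglyMeasurable ?_ ?_ hχ ?_
  · simpa [norm_gradient_sqrtGaussian_sq] using
      (integrable_sqrtGaussian_sq_mul_norm_sq hd).const_mul (1 / 4)
  · simpa using integrable_sqrtGaussian_sq d
  · simp

/-- The Gaussian shows that no constant below `2 / (π d e)` is admissible. -/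
theorem two_div_le_of_lsHolds {d : ℕ} (hd : 0 < d) {C : ℝ} (h : LSHolds d C) :
    2 / (Real.pi * d * Real.exp 1) ≤ C := by
  have hd' : (0 : ℝ) < d := by exact_mod_cast hd
  have e : ∀ x, sqrtGaussian d x ^ 2 * Real.log (sqrtGaussian d x ^ 2) =
      -(d / 2 * Real.log (2 * Real.pi)) * sqrtGaussian d x ^ 2 -
        1 / 2 * (sqrtGaussian d x ^ 2 * ‖x‖ ^ 2) := fun x => by
    nth_rewrite 2 [sqrtGaussian_sq]
    rw [Real.log_exp]; ring
  have i1 := (integrable_sqrtGaussian_sq d).const_mul (-(d / 2 * Real.log (2 * Real.pi)))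
  have i2 := (integrable_sqrtGaussian_sq_mul_norm_sq hd).const_mul (1 / 2)
  have key := h _ _ (memH1_sqrtGaussian hd) (integral_sqrtGaussian_sq d)
    (by simp only [e]; exact i1.sub i2)
  simp only [e, norm_gradient_sqrtGaussian_sq] at key
  rw [integral_sub i1 i2, integral_const_mul, integral_const_mul, integral_const_mul,
    integral_sqrtGaussian_sq, integral_sqrtGaussian_sq_mul_norm_sq] at key
  have e2 : 2 / (d : ℝ) * (-(d / 2 * Real.log (2 * Real.pi)) * 1 - 1 / 2 * d) =
      -(Real.log (2 * Real.pi) + 1) := by field_simp; ring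
  rw [e2, Real.exp_neg, Real.exp_add, Real.exp_log (by positivity)] at key
  calc 2 / (Real.pi * d * Real.exp 1) = (2 * Real.pi * Real.exp 1)⁻¹ * (4 / d) := by
        field_simp; norm_num
    _ ≤ C * (1 / 4 * d) * (4 / d) := mul_le_mul_of_nonneg_right key (by positivity)
    _ = C := by field_simp

theorem CLS_eq {d : ℕ} (hd : 0 < d) :
    CLS d = ENNReal.ofReal (2 / (Real.pi * d * Real.exp 1)) := by
  have hd' : (0 : ℝ) < d := by exact_mod_cast hd
  refine le_antisymm ?_ (le_iInf₂ fun C hC => ?_)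
  · refine iInf₂_le (Real.toNNReal (2 / (Real.pi * d * Real.exp 1))) ?_
    rw [Real.coe_toNNReal _ (by positivity)]
    exact lsHolds_two_div hd
  · rw [← ENNReal.ofReal_coe_nnreal]
    exact ENNReal.ofReal_le_ofReal (two_div_le_of_lsHolds hd hC)

/-! ### Radial functions in logarithmic polar coordinates -/

theorem integral_Ioi_inv_mul_comp_log (f : ℝ → ℝ) :
    ∫ y in Set.Ioi (0 : ℝ), y⁻¹ * f (Real.log y) = ∫ s, f s := by
  have h := integral_image_eq_integral_abs_deriv_smul MeasurableSet.univ
    (fun x _ => (Real.hasDerivAt_exp x).hasDerivWithinAt) Real.exp_injective.injOn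
    (fun y => y⁻¹ * f (Real.log y))
  rw [Set.image_univ, Real.range_exp] at h
  rw [h, setIntegral_univ]
  refine integral_congr_ae (Eventually.of_forall fun x => ?_)
  simp only [smul_eq_mul, Real.log_exp, abs_of_pos (Real.exp_pos x)]
  rw [← mul_assoc, mul_inv_cancel₀ (Real.exp_pos x).ne', one_mul]

theorem integrableOn_Ioi_inv_mul_comp_log {f : ℝ → ℝ} (hf : Integrable f) :
    IntegrableOn (fun y => y⁻¹ * f (Real.log y)) (Set.Ioi 0) := by
  have h := integrableOn_image_iff_integrableOn_abs_deriv_smul MeasurableSet.univ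
    (fun x _ => (Real.hasDerivAt_exp x).hasDerivWithinAt) Real.exp_injective.injOn
    (fun y => y⁻¹ * f (Real.log y))
  rw [Set.image_univ, Real.range_exp, integrableOn_univ] at h
  refine h.2 (hf.congr (Eventually.of_forall fun x => ?_))
  simp only [smul_eq_mul, Real.log_exp, abs_of_pos (Real.exp_pos x)]
  rw [← mul_assoc, mul_inv_cancel₀ (Real.exp_pos x).ne', one_mul]

/-- The area `2 π^{d/2} / Γ(d/2)` of the unit sphere in `ℝ^d`. -/
noncomputable def sphereArea (d : ℕ) : ℝ :=
  2 * Real.pi ^ ((d : ℝ) / 2) / Real.Gamma ((d : ℝ) / 2)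

theorem sphereArea_pos {d : ℕ} (hd : 0 < d) : 0 < sphereArea d := by
  have hd' : (0 : ℝ) < d := by exact_mod_cast hd
  have := Real.Gamma_pos_of_pos (show (0 : ℝ) < d / 2 by positivity)
  unfold sphereArea; positivity

theorem natCast_mul_volume_ball {d : ℕ} (hd : 0 < d) :
    (d : ℝ) * (volume : Measure (EuclideanSpace ℝ (Fin d))).real (Metric.ball 0 1) =
      sphereArea d := by
  have hd' : (0 : ℝ) < d := by exact_mod_cast hd
  have : Nonempty (Fin d) := ⟨⟨0, hd⟩⟩
  have hG := Real.Gamma_pos_of_pos (show (0 : ℝ) < d / 2 by positivity)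
  rw [Measure.real, EuclideanSpace.volume_ball]
  simp only [Fintype.card_fin, ENNReal.ofReal_one, one_pow, one_mul]
  have e : √Real.pi ^ d = Real.pi ^ ((d : ℝ) / 2) := by
    rw [Real.sqrt_eq_rpow, ← Real.rpow_natCast, ← Real.rpow_mul Real.pi_pos.le]
    congr 1; ring
  have hG1 : Real.Gamma ((d : ℝ) / 2 + 1) = d / 2 * Real.Gamma (d / 2) :=
    Real.Gamma_add_one (by positivity)
  rw [e, hG1, ENNReal.toReal_ofReal (by positivity), sphereArea]
  field_simp

theorem pow_pred_mul_rpow_neg {d : ℕ} (hd : 0 < d) {y : ℝ} (hy : 0 < y) :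
    y ^ (d - 1) * y ^ (-(d : ℝ)) = y⁻¹ := by
  rw [← Real.rpow_natCast, ← Real.rpow_add hy, Nat.cast_sub (Nat.one_le_iff_ne_zero.2 hd.ne'),
    ← Real.rpow_neg_one]
  congr 1; push_cast; ring

/-- Polar coordinates `|x| = e^s` turn `|x|^{-d} dx` into the area of the sphere times `ds`. -/
theorem integral_norm_rpow_neg_mul_comp_log {d : ℕ} (hd : 0 < d) (f : ℝ → ℝ) :
    ∫ x : EuclideanSpace ℝ (Fin d), ‖x‖ ^ (-(d : ℝ)) * f (Real.log ‖x‖) =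
      sphereArea d * ∫ s, f s := by
  have : Nonempty (Fin d) := ⟨⟨0, hd⟩⟩
  have h := integral_fun_norm_addHaar (volume : Measure (EuclideanSpace ℝ (Fin d)))
    (fun y => y ^ (-(d : ℝ)) * f (Real.log y))
  rw [h, ← integral_Ioi_inv_mul_comp_log f, ← natCast_mul_volume_ball hd]
  simp only [finrank_euclideanSpace, Fintype.card_fin, nsmul_eq_mul, smul_eq_mul]
  rw [mul_assoc]
  congr 2
  refine setIntegral_congr_fun measurableSet_Ioi fun y hy => ?_
  rw [← mul_assoc, pow_pred_mul_rpow_neg hd hy]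

theorem integrable_norm_rpow_neg_mul_comp_log {d : ℕ} (hd : 0 < d) {f : ℝ → ℝ}
    (hf : Integrable f) :
    Integrable fun x : EuclideanSpace ℝ (Fin d) => ‖x‖ ^ (-(d : ℝ)) * f (Real.log ‖x‖) := by
  have : Nonempty (Fin d) := ⟨⟨0, hd⟩⟩
  refine (integrable_fun_norm_addHaar (volume : Measure (EuclideanSpace ℝ (Fin d)))
    (f := fun y => y ^ (-(d : ℝ)) * f (Real.log y))).2 ?_
  refine (integrableOn_Ioi_inv_mul_comp_log hf).congr_fun (fun y hy => ?_) measurableSet_Ioi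
  simp only [finrank_euclideanSpace, Fintype.card_fin, smul_eq_mul]
  rw [← mul_assoc, pow_pred_mul_rpow_neg hd hy]

section LogNorm

variable {E : Type*} [NormedAddCommGroup E] [InnerProductSpace ℝ E]

theorem contDiffAt_log_norm {x : E} (hx : x ≠ 0) : ContDiffAt ℝ ∞ (fun y : E => Real.log ‖y‖) x :=
  (contDiffAt_norm ℝ hx).log (norm_ne_zero_iff.2 hx)

theorem gradient_log_norm [CompleteSpace E] {x : E} (hx : x ≠ 0) :
    gradient (fun y : E => Real.log ‖y‖) x = (‖x‖ ^ 2)⁻¹ • x := by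
  have hx' : ‖x‖ ^ 2 ≠ 0 := pow_ne_zero 2 (norm_ne_zero_iff.2 hx)
  have e : (fun y : E => Real.log ‖y‖) = fun y : E => 1 / 2 * Real.log (‖y‖ ^ 2) := by
    ext y; rw [Real.log_pow]; push_cast; ring
  have h := gradient_comp_hasDerivAt (h := fun y : E => ‖y‖ ^ 2)
    ((Real.hasDerivAt_log hx').const_mul (1 / 2))
    (hasStrictFDerivAt_norm_sq x).hasFDerivAt.differentiableAt
  rw [e, h, gradient_norm_sq, smul_smul]
  congr 1; ring

theorem norm_gradient_log_norm [CompleteSpace E] {x : E} (hx : x ≠ 0) :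
    ‖gradient (fun y : E => Real.log ‖y‖) x‖ = ‖x‖⁻¹ := by
  have hx' : ‖x‖ ≠ 0 := norm_ne_zero_iff.2 hx
  rw [gradient_log_norm hx, norm_smul, norm_inv, norm_pow, norm_norm]
  field_simp

/-- Cutoffs in the logarithmic radial variable: their gradients are of size `1 / (k ‖x‖)`, which is
what Hardy weights tolerate. -/
theorem exists_isCutoffSeq_compl_zero [FiniteDimensional ℝ E] :
    ∃ (C : ℝ) (χ : ℕ → E → ℝ), IsCutoffSeq ({0}ᶜ : Set E) (fun x => C / ‖x‖) χ := by
  classical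
  let b : ContDiffBump (0 : ℝ) := ⟨1, 2, one_pos, one_lt_two⟩
  have hb : ContDiff ℝ ∞ b := b.contDiff
  have hbd : Differentiable ℝ b := hb.differentiable (by simp)
  obtain ⟨C, hC⟩ := b.hasCompactSupport.deriv.exists_bound_of_continuous
    (hb.continuous_deriv (by simp))
  have hk : ∀ k : ℕ, (0 : ℝ) < (k : ℝ) + 1 := fun k => by positivity
  -- the value at the origin has to be corrected because `Real.log 0 = 0`
  set χ : ℕ → E → ℝ := fun k x => if x = 0 then 0 else b (Real.log ‖x‖ / ((k : ℝ) + 1)) with hχ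
  have hne : ∀ k x, x ≠ 0 → χ k =ᶠ[𝓝 x] fun y => b (Real.log ‖y‖ / ((k : ℝ) + 1)) :=
    fun k x hx => by
      filter_upwards [isOpen_ne.mem_nhds hx] with y hy
      simp only [hχ, if_neg hy]
  have hbz : ∀ t : ℝ, 2 ≤ |t| → b t = 0 := fun t ht =>
    b.zero_of_le_dist (by rw [Real.dist_eq, sub_zero]; exact ht)
  have hz : ∀ k, χ k =ᶠ[𝓝 0] fun _ => 0 := fun k => by
    filter_upwards [Metric.ball_mem_nhds (0 : E) (Real.exp_pos (-(2 * ((k : ℝ) + 1))))] with y hy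
    by_cases h0 : y = 0
    · simp [hχ, h0]
    · simp only [hχ, if_neg h0]
      refine hbz _ ?_
      rw [mem_ball_zero_iff] at hy
      have h1 := (Real.log_lt_iff_lt_exp (norm_pos_iff.2 h0)).2 hy
      rw [abs_div, abs_of_pos (hk k), le_div_iff₀ (hk k)]
      exact le_trans (by linarith) (neg_le_abs _)
  have hgz : ∀ k, gradient (χ k) 0 = 0 := fun k => by
    rw [(hz k).gradient_eq, gradient_fun_const]
  refine ⟨C, χ, fun k => contDiff_iff_contDiffAt.2 fun x => ?_, fun k => ?_, fun k x hx => ?_,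
    fun k x => ?_, fun k x => ?_, fun x hx => ?_, fun k x => ?_⟩
  · by_cases hx : x = 0
    · subst hx
      exact contDiffAt_const.congr_of_eventuallyEq (hz k)
    · exact (hb.contDiffAt.comp x ((contDiffAt_log_norm hx).div_const _)).congr_of_eventuallyEq
        (hne k x hx)
  · refine HasCompactSupport.intro
      (isCompact_closedBall (0 : E) (Real.exp (2 * ((k : ℝ) + 1)))) fun x hx => ?_
    rw [mem_closedBall_zero_iff, not_le] at hx
    have hx0 : 0 < ‖x‖ := (Real.exp_pos _).trans hx
    simp only [hχ, if_neg (norm_pos_iff.1 hx0)]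
    refine hbz _ ?_
    have h1 := (Real.lt_log_iff_exp_lt hx0).2 hx
    rw [abs_div, abs_of_pos (hk k), le_div_iff₀ (hk k)]
    exact h1.le.trans (le_abs_self _)
  · rintro rfl
    exact notMem_tsupport_iff_eventuallyEq.2 (hz k) hx
  · simp only [hχ]; split_ifs
    · exact le_rfl
    · exact b.nonneg
  · simp only [hχ]; split_ifs
    · exact zero_le_one
    · exact b.le_one
  · filter_upwards [eventually_ge_atTop ⌈|Real.log ‖x‖|⌉₊] with k hk'
    simp only [hχ, if_neg (show x ≠ 0 from hx)]
    refine b.one_of_mem_closedBall ?_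
    rw [mem_closedBall_zero_iff, norm_div, Real.norm_of_nonneg (hk k).le, Real.norm_eq_abs,
      div_le_iff₀ (hk k)]
    have : |Real.log ‖x‖| ≤ k := Nat.ceil_le.1 hk'
    change _ ≤ 1 * _
    linarith
  · by_cases hx : x = 0
    · subst hx
      rw [hgz]; simp
    · rw [(hne k x hx).gradient_eq]
      have h1 : HasDerivAt (fun s : ℝ => b (s / ((k : ℝ) + 1)))
          (deriv b (Real.log ‖x‖ / ((k : ℝ) + 1)) * (1 / ((k : ℝ) + 1))) (Real.log ‖x‖) :=
        (hbd _).hasDerivAt.comp _ ((hasDerivAt_id _).div_const _)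
      rw [gradient_comp_hasDerivAt (h := fun y : E => Real.log ‖y‖) h1
        ((contDiffAt_log_norm hx).differentiableAt (by simp)),
        norm_smul, norm_gradient_log_norm hx, norm_mul,
        Real.norm_of_nonneg (one_div_pos.2 (hk k)).le]
      have h2 := hC (Real.log ‖x‖ / ((k : ℝ) + 1))
      have h3 : 0 ≤ 1 / ((k : ℝ) + 1) * ‖x‖⁻¹ := by positivity
      calc _ = ‖deriv b (Real.log ‖x‖ / ((k : ℝ) + 1))‖ * (1 / ((k : ℝ) + 1) * ‖x‖⁻¹) := by ring
        _ ≤ C * (1 / ((k : ℝ) + 1) * ‖x‖⁻¹) := mul_le_mul_of_nonneg_right h2 h3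
        _ = _ := by field_simp

end LogNorm

/-! ### The radial weighted logarithmic Hardy inequality -/

theorem integrable_sq_mul_exp_neg_mul_sq {b : ℝ} (hb : 0 < b) :
    Integrable fun s : ℝ => s ^ 2 * Real.exp (-b * s ^ 2) := by
  have := integrable_rpow_mul_exp_neg_mul_sq hb (s := 2) (by norm_num)
  simpa only [Real.rpow_two] using this

theorem integral_id_mul_exp_neg_mul_sq {b : ℝ} (hb : 0 < b) :
    ∫ s : ℝ, s * Real.exp (-b * s ^ 2) = 0 := by
  have hd : ∀ s : ℝ, HasDerivAt (fun s => Real.exp (-b * s ^ 2))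
      (-(2 * b) * (s * Real.exp (-b * s ^ 2))) s := fun s =>
    (((hasDerivAt_pow 2 s).const_mul (-b)).exp).congr_deriv (by push_cast; ring)
  have h := integral_eq_zero_of_hasDerivAt_of_integrable hd
    ((integrable_mul_exp_neg_mul_sq hb).const_mul _) (integrable_exp_neg_mul_sq hb)
  rw [integral_const_mul] at h
  exact (mul_eq_zero.1 h).resolve_left (by linarith)

theorem integral_sq_mul_exp_neg_mul_sq {b : ℝ} (hb : 0 < b) :
    ∫ s : ℝ, s ^ 2 * Real.exp (-b * s ^ 2) = (2 * b)⁻¹ * √(Real.pi / b) := by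
  have hd : ∀ s : ℝ, HasDerivAt (fun s => s * Real.exp (-b * s ^ 2))
      (Real.exp (-b * s ^ 2) - 2 * b * (s ^ 2 * Real.exp (-b * s ^ 2))) s := fun s =>
    ((hasDerivAt_id s).mul (((hasDerivAt_pow 2 s).const_mul (-b)).exp)).congr_deriv
      (by simp; ring)
  have i2 := (integrable_sq_mul_exp_neg_mul_sq hb).const_mul (2 * b)
  have h := integral_eq_zero_of_hasDerivAt_of_integrable hd
    ((integrable_exp_neg_mul_sq hb).sub i2) (integrable_mul_exp_neg_mul_sq hb)
  rw [integral_sub (integrable_exp_neg_mul_sq hb) i2, integral_const_mul, integral_gaussian] at h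
  rw [eq_inv_mul_iff_mul_eq₀ (by positivity)]
  linarith

/-- In the variables `s = log |x|`, `u = |x|^{-α} w(s)`, the function with `w` a Gaussian. Its value
at the origin, `A`, is a junk value on a null set. -/
noncomputable def logGaussian {d : ℕ} (A α t : ℝ) (x : EuclideanSpace ℝ (Fin d)) : ℝ :=
  A * Real.exp (-α * Real.log ‖x‖ - t * Real.log ‖x‖ ^ 2)

theorem logGaussian_sq {d : ℕ} (A α t : ℝ) {x : EuclideanSpace ℝ (Fin d)} (hx : x ≠ 0) :
    logGaussian A α t x ^ 2 =
      A ^ 2 * ‖x‖ ^ (-2 * α) * Real.exp (-(2 * t) * Real.log ‖x‖ ^ 2) := by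
  rw [logGaussian, mul_pow, ← Real.exp_nat_mul, Real.rpow_def_of_pos (norm_pos_iff.2 hx),
    mul_assoc, ← Real.exp_add]
  congr 2; push_cast; ring

theorem norm_gradient_logGaussian_sq {d : ℕ} (A α t : ℝ) {x : EuclideanSpace ℝ (Fin d)}
    (hx : x ≠ 0) : ‖gradient (logGaussian A α t) x‖ ^ 2 =
      logGaussian A α t x ^ 2 * (α + 2 * t * Real.log ‖x‖) ^ 2 * ‖x‖ ^ (-2 : ℝ) := by
  have h1 : HasDerivAt (fun s : ℝ => A * Real.exp (-α * s - t * s ^ 2))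
      (logGaussian A α t x * -(α + 2 * t * Real.log ‖x‖)) (Real.log ‖x‖) := by
    refine (((((hasDerivAt_id _).const_mul (-α)).sub
      ((hasDerivAt_pow 2 _).const_mul t)).exp).const_mul A).congr_deriv ?_
    simp only [logGaussian, id, mul_one, Pi.sub_apply]
    push_cast; ring
  have h2 := gradient_comp_hasDerivAt
    (h := fun y : EuclideanSpace ℝ (Fin d) => Real.log ‖y‖) h1
    ((contDiffAt_log_norm hx).differentiableAt (by simp))
  change gradient (logGaussian A α t) x = _ at h2
  rw [h2, norm_smul, norm_gradient_log_norm hx, mul_pow, Real.norm_eq_abs, sq_abs,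
    Real.rpow_neg (norm_nonneg _), Real.rpow_two]
  ring

theorem contDiffOn_logGaussian {d : ℕ} (A α t : ℝ) :
    ContDiffOn ℝ ∞ (logGaussian A α t : EuclideanSpace ℝ (Fin d) → ℝ) {0}ᶜ := fun x hx => by
  have h := contDiffAt_log_norm (show x ≠ 0 from hx)
  exact (contDiffAt_const.mul
    ((contDiffAt_const.mul h).sub (contDiffAt_const.mul (h.pow 2))).exp).contDiffWithinAt

theorem measurable_logGaussian {d : ℕ} (A α t : ℝ) :
    Measurable (logGaussian A α t : EuclideanSpace ℝ (Fin d) → ℝ) := by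
  unfold logGaussian
  have : Measurable fun x : EuclideanSpace ℝ (Fin d) => Real.log ‖x‖ :=
    Real.measurable_log.comp measurable_norm
  fun_prop

/-- Evaluation of the radial inequality at `logGaussian`, with `s = log |x|` of variance `1 / (4 t)`
for the probability measure `|x|^{-2 (a + 1)} u² dx`. -/
theorem le_of_radialWLHHolds {d : ℕ} (hd : 0 < d) {γ a C t : ℝ} (ht : 0 < t)
    (h : RadialWLHHolds d γ a C) :
    Real.exp (1 / (2 * γ) *
      (Real.log ((sphereArea d * √(Real.pi / (2 * t)))⁻¹) - 1 / 2)) ≤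
      C * ((aCrit d - a) ^ 2 + t) := by
  set α := aCrit d - a with hα
  set b := 2 * t with hb
  have hb0 : 0 < b := by positivity
  set S := sphereArea d with hS
  have hS0 : 0 < S := sphereArea_pos hd
  set J := √(Real.pi / b) with hJ
  have hJ0 : 0 < J := Real.sqrt_pos.2 (by positivity)
  set A := √(S * J)⁻¹ with hA
  have hA2 : A ^ 2 = (S * J)⁻¹ := Real.sq_sqrt (by positivity)
  have hA20 : 0 < A ^ 2 := by rw [hA2]; positivity
  set u : EuclideanSpace ℝ (Fin d) → ℝ := logGaussian A α t with hu
  have hexp : -2 * (a + 1) + -2 * α = -(d : ℝ) := by rw [hα, aCrit]; ring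
  have : Nonempty (Fin d) := ⟨⟨0, hd⟩⟩
  have hne : ∀ᵐ x : EuclideanSpace ℝ (Fin d), x ≠ 0 := by
    rw [ae_iff]; simp
  -- the three integrands in the variable `s = log |x|`
  have hw : ∀ x : EuclideanSpace ℝ (Fin d), x ≠ 0 → ‖x‖ ^ (-2 * (a + 1)) * u x ^ 2 =
      ‖x‖ ^ (-(d : ℝ)) * (A ^ 2 * Real.exp (-b * Real.log ‖x‖ ^ 2)) := fun x hx => by
    rw [hu, logGaussian_sq A α t hx, ← hexp, Real.rpow_add (norm_pos_iff.2 hx)]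
    ring
  have hent : ∀ x : EuclideanSpace ℝ (Fin d), x ≠ 0 →
      Real.log (‖x‖ ^ (2 * α) * u x ^ 2) = Real.log (A ^ 2) - b * Real.log ‖x‖ ^ 2 :=
    fun x hx => by
    have hx0 := norm_pos_iff.2 hx
    have e : ‖x‖ ^ (2 * α) * u x ^ 2 = A ^ 2 * Real.exp (-b * Real.log ‖x‖ ^ 2) := by
      rw [hu, logGaussian_sq A α t hx]
      have : ‖x‖ ^ (2 * α) * ‖x‖ ^ (-2 * α) = 1 := by
        rw [← Real.rpow_add hx0, show 2 * α + -2 * α = 0 by ring, Real.rpow_zero]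
      linear_combination A ^ 2 * Real.exp (-b * Real.log ‖x‖ ^ 2) * this
    rw [e, Real.log_mul hA20.ne' (Real.exp_pos _).ne', Real.log_exp]
    ring
  have hgr : ∀ x : EuclideanSpace ℝ (Fin d), x ≠ 0 →
      ‖x‖ ^ (-2 * a) * ‖gradient u x‖ ^ 2 = ‖x‖ ^ (-(d : ℝ)) *
        (A ^ 2 * ((α + b * Real.log ‖x‖) ^ 2 * Real.exp (-b * Real.log ‖x‖ ^ 2))) :=
    fun x hx => by
    rw [hu, norm_gradient_logGaussian_sq A α t hx, ← hu]
    have e : ‖x‖ ^ (-2 * (a + 1)) = ‖x‖ ^ (-2 * a) * ‖x‖ ^ (-2 : ℝ) := by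
      rw [← Real.rpow_add (norm_pos_iff.2 hx)]; congr 1; ring
    have := hw x hx
    rw [e] at this
    linear_combination (α + b * Real.log ‖x‖) ^ 2 * this
  -- integrals over the line
  have i0 := integrable_exp_neg_mul_sq hb0
  have i1 := integrable_mul_exp_neg_mul_sq hb0
  have i2 := integrable_sq_mul_exp_neg_mul_sq hb0
  have I0 : ∫ s : ℝ, Real.exp (-b * s ^ 2) = J := integral_gaussian b
  have I1 := integral_id_mul_exp_neg_mul_sq hb0
  have I2 := integral_sq_mul_exp_neg_mul_sq hb0
  rw [← hJ] at I2
  have eE : (fun s : ℝ => A ^ 2 * Real.exp (-b * s ^ 2) * (Real.log (A ^ 2) - b * s ^ 2)) =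
      fun s => A ^ 2 * Real.log (A ^ 2) * Real.exp (-b * s ^ 2) -
        A ^ 2 * b * (s ^ 2 * Real.exp (-b * s ^ 2)) := by ext s; ring
  have iE : Integrable fun s : ℝ =>
      A ^ 2 * Real.exp (-b * s ^ 2) * (Real.log (A ^ 2) - b * s ^ 2) := by
    rw [eE]; exact (i0.const_mul _).sub (i2.const_mul _)
  have IE : ∫ s : ℝ, A ^ 2 * Real.exp (-b * s ^ 2) * (Real.log (A ^ 2) - b * s ^ 2) =
      A ^ 2 * J * (Real.log (A ^ 2) - 1 / 2) := by
    rw [eE, integral_sub (i0.const_mul _) (i2.const_mul _), integral_const_mul,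
      integral_const_mul, I0, I2]
    field_simp
  have eG : (fun s : ℝ => A ^ 2 * ((α + b * s) ^ 2 * Real.exp (-b * s ^ 2))) = fun s =>
      A ^ 2 * α ^ 2 * Real.exp (-b * s ^ 2) + 2 * A ^ 2 * α * b * (s * Real.exp (-b * s ^ 2)) +
        A ^ 2 * b ^ 2 * (s ^ 2 * Real.exp (-b * s ^ 2)) := by ext s; ring
  have iG : Integrable fun s : ℝ => A ^ 2 * ((α + b * s) ^ 2 * Real.exp (-b * s ^ 2)) := by
    rw [eG]; exact ((i0.const_mul _).add (i1.const_mul _)).add (i2.const_mul _)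
  have IG : ∫ s : ℝ, A ^ 2 * ((α + b * s) ^ 2 * Real.exp (-b * s ^ 2)) =
      A ^ 2 * J * (α ^ 2 + t) := by
    rw [eG, integral_add_three (i0.const_mul _) (i1.const_mul _) (i2.const_mul _),
      integral_const_mul, integral_const_mul, integral_const_mul, I0, I1, I2, hb]
    field_simp
    ring
  have hSJ : S * (A ^ 2 * J) = 1 := by rw [hA2]; field_simp
  have hcw : ∀ᵐ x : EuclideanSpace ℝ (Fin d), ‖x‖ ^ (-(d : ℝ)) *
      (A ^ 2 * Real.exp (-b * Real.log ‖x‖ ^ 2)) = ‖x‖ ^ (-2 * (a + 1)) * u x ^ 2 :=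
    hne.mono fun x hx => (hw x hx).symm
  have hcE : ∀ᵐ x : EuclideanSpace ℝ (Fin d), ‖x‖ ^ (-(d : ℝ)) *
      (A ^ 2 * Real.exp (-b * Real.log ‖x‖ ^ 2) * (Real.log (A ^ 2) - b * Real.log ‖x‖ ^ 2)) =
      ‖x‖ ^ (-2 * (a + 1)) * u x ^ 2 * Real.log (‖x‖ ^ (2 * α) * u x ^ 2) :=
    hne.mono fun x hx => by rw [hw x hx, hent x hx]; ring
  have hcG : ∀ᵐ x : EuclideanSpace ℝ (Fin d), ‖x‖ ^ (-(d : ℝ)) *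
      (A ^ 2 * ((α + b * Real.log ‖x‖) ^ 2 * Real.exp (-b * Real.log ‖x‖ ^ 2))) =
      ‖x‖ ^ (-2 * a) * ‖gradient u x‖ ^ 2 := hne.mono fun x hx => (hgr x hx).symm
  obtain ⟨C', χ, hχ⟩ := exists_isCutoffSeq_compl_zero (E := EuclideanSpace ℝ (Fin d))
  have hmem : MemD12 a u (gradient u) := by
    refine isSobolevLimit_of_isCutoffSeq (C := C' ^ 2) isOpen_compl_singleton (by simp)
      (contDiffOn_logGaussian A α t) (measurable_logGaussian A α t).aestronglyMeasurable
      ((integrable_norm_rpow_neg_mul_comp_log hd iG).congr hcG)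
      ((integrable_norm_rpow_neg_mul_comp_log hd (i0.const_mul (A ^ 2))).congr hcw) hχ
      fun x hx => le_of_eq ?_
    have hx0 : 0 < ‖x‖ := norm_pos_iff.2 hx
    have e : ‖x‖ ^ (-2 * (a + 1)) = ‖x‖ ^ (-2 * a) * (‖x‖ ^ 2)⁻¹ := by
      rw [← Real.rpow_two, ← Real.rpow_neg hx0.le, ← Real.rpow_add hx0]; congr 1; ring
    rw [e, div_pow]; ring
  have key := h u (gradient u) hmem (fun x y hxy => by simp only [hu, logGaussian, hxy]) (by
      rw [← integral_congr_ae hcw, integral_norm_rpow_neg_mul_comp_log hd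
        (fun s => A ^ 2 * Real.exp (-b * s ^ 2)), integral_const_mul, I0]
      exact hSJ)
    ((integrable_norm_rpow_neg_mul_comp_log hd iE).congr hcE)
  rw [← hα, ← integral_congr_ae hcE, ← integral_congr_ae hcG,
    integral_norm_rpow_neg_mul_comp_log hd
      (fun s => A ^ 2 * Real.exp (-b * s ^ 2) * (Real.log (A ^ 2) - b * s ^ 2)), IE,
    integral_norm_rpow_neg_mul_comp_log hd
      (fun s => A ^ 2 * ((α + b * s) ^ 2 * Real.exp (-b * s ^ 2))), IG, ← hS] at key
  have hnorm : ∀ y, S * (A ^ 2 * J * y) = y := fun y => by rw [← mul_assoc, hSJ, one_mul]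
  rwa [hnorm, hnorm, hA2] at key

theorem log_LambdaStar {d : ℕ} (hd : 3 ≤ d) :
    Real.log (LambdaStar d) = Real.log ((d : ℝ) - 1) + 1 -
      (((d : ℝ) + 1) * Real.log 2 + Real.log Real.pi) / ((d : ℝ) - 1) +
      2 * Real.log (Real.Gamma ((d : ℝ) / 2)) / ((d : ℝ) - 1) := by
  have hd' : (3 : ℝ) ≤ d := by exact_mod_cast hd
  have h1 : (0 : ℝ) < (d : ℝ) - 1 := by linarith
  have hG : 0 < Real.Gamma ((d : ℝ) / 2) := Real.Gamma_pos_of_pos (by linarith)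
  have hP := Real.pi_pos
  rw [LambdaStar, Real.log_mul (by positivity) (by positivity),
    Real.log_mul (by positivity) (by positivity), Real.log_mul h1.ne' (Real.exp_pos 1).ne',
    Real.log_exp, Real.log_rpow (by positivity), Real.log_rpow hG,
    Real.log_mul (by positivity) hP.ne', Real.log_pow]
  push_cast
  ring

theorem LambdaStar_pos {d : ℕ} (hd : 3 ≤ d) : 0 < LambdaStar d := by
  have hd' : (3 : ℝ) ≤ d := by exact_mod_cast hd
  have h1 : (0 : ℝ) < (d : ℝ) - 1 := by linarith
  have hG : 0 < Real.Gamma ((d : ℝ) / 2) := Real.Gamma_pos_of_pos (by linarith)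
  have hP := Real.pi_pos
  unfold LambdaStar; positivity

/-- `Λ < Λ_⋆` is exactly the condition that the value at the optimal log-Gaussian, with
`t = Λ / (d - 1)`, exceeds the Euclidean constant. -/
theorem two_div_lt_of_lt_LambdaStar {d : ℕ} (hd : 3 ≤ d) {t : ℝ} (ht : 0 < t)
    (h : ((d : ℝ) - 1) * t < LambdaStar d) :
    2 / (Real.pi * d * Real.exp 1) < Real.exp (1 / (2 * ((d : ℝ) / 4)) *
      (Real.log ((sphereArea d * √(Real.pi / (2 * t)))⁻¹) - 1 / 2)) / (d * t) := by
  have hd' : (3 : ℝ) ≤ d := by exact_mod_cast hd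
  have h1 : (0 : ℝ) < (d : ℝ) - 1 := by linarith
  have h0 : (0 : ℝ) < d := by linarith
  have hG : 0 < Real.Gamma ((d : ℝ) / 2) := Real.Gamma_pos_of_pos (by linarith)
  have hP := Real.pi_pos
  have hS := sphereArea_pos (d := d) (by lia)
  have hlog := Real.log_lt_log (by positivity) h
  rw [log_LambdaStar hd, Real.log_mul h1.ne' ht.ne'] at hlog
  have hlog2 : ((d : ℝ) - 1) * Real.log t < ((d : ℝ) - 1) -
      (((d : ℝ) + 1) * Real.log 2 + Real.log Real.pi) +
      2 * Real.log (Real.Gamma ((d : ℝ) / 2)) := by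
    have := mul_lt_mul_of_pos_left hlog h1
    have e : ((d : ℝ) - 1) * (Real.log ((d : ℝ) - 1) + 1 -
      (((d : ℝ) + 1) * Real.log 2 + Real.log Real.pi) / ((d : ℝ) - 1) +
      2 * Real.log (Real.Gamma ((d : ℝ) / 2)) / ((d : ℝ) - 1)) =
      ((d : ℝ) - 1) * Real.log ((d : ℝ) - 1) + ((d : ℝ) - 1) -
      (((d : ℝ) + 1) * Real.log 2 + Real.log Real.pi) +
      2 * Real.log (Real.Gamma ((d : ℝ) / 2)) := by field_simp
    rw [e] at this
    linarith
  have eS : Real.log ((sphereArea d * √(Real.pi / (2 * t)))⁻¹) =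
      -(Real.log 2 + d / 2 * Real.log Real.pi - Real.log (Real.Gamma ((d : ℝ) / 2))) -
        (Real.log Real.pi - (Real.log 2 + Real.log t)) / 2 := by
    rw [Real.log_inv, Real.log_mul hS.ne' (by positivity), Real.log_sqrt (by positivity),
      Real.log_div hP.ne' (by positivity), Real.log_mul two_ne_zero ht.ne', sphereArea,
      Real.log_div (by positivity) hG.ne', Real.log_mul two_ne_zero (by positivity),
      Real.log_rpow hP]
    ring
  rw [lt_div_iff₀ (by positivity), eS]
  have e2 : 2 / (Real.pi * d * Real.exp 1) * (d * t) =
      Real.exp (Real.log 2 + Real.log t - Real.log Real.pi - 1) := by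
    rw [Real.exp_sub, Real.exp_sub, Real.exp_add, Real.exp_log two_pos, Real.exp_log ht,
      Real.exp_log hP]
    field_simp
  rw [e2, Real.exp_lt_exp]
  have e3 : 1 / (2 * ((d : ℝ) / 4)) = 2 / d := by field_simp; norm_num
  rw [e3, div_mul_eq_mul_div, lt_div_iff₀ h0]
  linarith

theorem proposition8 (d : ℕ) (hd : 3 ≤ d) (a : ℝ) (ha : a ∈ Set.Ioo (aStar d) (aCrit d)) :
    CLS d = ENNReal.ofReal (2 / (Real.pi * d * Real.exp 1)) ∧
      CLS d < CWLHRadial d ((d : ℝ) / 4) a := by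
  have hd0 : 0 < d := by lia
  refine ⟨CLS_eq hd0, ?_⟩
  rw [CLS_eq hd0]
  have hd' : (3 : ℝ) ≤ d := by exact_mod_cast hd
  have h1 : (0 : ℝ) < (d : ℝ) - 1 := by linarith
  have hα : 0 < aCrit d - a := sub_pos.2 ha.2
  have hΛ : (aCrit d - a) ^ 2 < LambdaStar d := by
    have h2 : aCrit d - a < √(LambdaStar d) := by
      have := ha.1
      rw [aStar] at this
      linarith
    have h3 := pow_lt_pow_left₀ h2 hα.le two_ne_zero
    rwa [Real.sq_sqrt (LambdaStar_pos hd).le] at h3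
  -- the optimal variance of the log-Gaussian
  set t := (aCrit d - a) ^ 2 / ((d : ℝ) - 1) with ht
  have ht0 : 0 < t := by positivity
  have hdt : ((d : ℝ) - 1) * t = (aCrit d - a) ^ 2 := mul_div_cancel₀ _ h1.ne'
  have hlt := two_div_lt_of_lt_LambdaStar hd ht0 (hdt ▸ hΛ)
  refine lt_of_lt_of_le ((ENNReal.ofReal_lt_ofReal_iff_of_nonneg (by positivity)).2 hlt)
    (le_iInf₂ fun C hC => ?_)
  rw [← ENNReal.ofReal_coe_nnreal]
  refine ENNReal.ofReal_le_ofReal ?_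
  rw [div_le_iff₀ (by positivity)]
  refine (le_of_radialWLHHolds hd0 ht0 hC).trans_eq ?_
  rw [← hdt]
  ring
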